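/- Let $\Omega_1\subset\mathbb{R}^{n_1}$ and $\Omega_2\subset\mathbb{R}^{n_2+\dots+n_k}$ be bounded open sets such that $\Omega=\Omega_1\times\Omega_2\subset\mathbb{R}^N$, $N=n_1+\dots+n_k$, has Lipschitz boundary. Write points of $\Omega$ as $(x_1,\dots,x_k)$ with $x_i\in\mathbb{R}^{n_i}$, let $\nabla_{x_i}$ be the weak gradient in the variables $x_i$, and let $p_1=1$ and $1<p_i<\infty$ for $i=2,\dots,k$. Let $W_0^{1,(p_i)_{i\ge2}}(\Omega_2)$ be the set of $v\in W^{1,1}_0(\Omega_2)$ with $\nabla_{x_i}v\in L^{p_i}(\Omega_2;\mathbb{R}^{n_i})$ for $i=2,\dots,k$, and let $W^{1,(p_i)}_{0,w}(\Omega)$ be the set of $u\in W^{1,1}(\Omega)$ such that $\nabla_{x_i}u\in L^{p_i}(\Omega;\mathbb{R}^{n_i})$ for $i=1,\dots,k$ and such that for a.e. $x_1\in\Omega_1$ the function $(x_2,\dots,x_k)\mapsto u(x_1,x_2,\dots,x_k)$ belongs to $W_0^{1,(p_i)_{i\ge2}}(\Omega_2)$. Let $f\in L^1(\partial\Omega_1\times\Omega_2)$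 with respect to the Hausdorff measure $\mathcal{H}^{N-1}$. Then for every $\varepsilon>0$ there exists $u\in W^{1,(p_i)}_{0,w}(\Omega)$ whose trace on $\partial\Omega$ equals $f$ $\mathcal{H}^{N-1}$-a.e. on $\partial\Omega_1\times\Omega_2$, such that $$\mathrm{supp}(u)\subset\{x\in\Omega:\ \mathrm{dist}(x,\partial\Omega_1\times\Omega_2)\le\varepsilon\}$$ (the support being taken relative to $\Omega$), $$\int_\Omega|\nabla_{x_1}u|\,dx\le(1+\varepsilon)\,\|f\|_{L^1(\partial\Omega_1\times\Omega_2)},$$ and, for all $i=2,\dots,k$, $$\int_\Omega|\nabla_{x_i}u|^{p_i}\,dx\le\varepsilon\,\|f\|_{L^1(\partial\Omega_1\times\Omega_2)}.$$ -/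

import Mathlib

open MeasureTheory Filter Topology Set
open scoped ContDiff

noncomputable section

namespace AnisoGagliardo

section General

variable {E : Type*} [NormedAddCommGroup E] [InnerProductSpace ℝ E] [FiniteDimensional ℝ E]
  [CompleteSpace E] [MeasurableSpace E] [BorelSpace E]

/-- The set `Ω` has Lipschitz boundary: near each boundary point it is, in the coordinates given by
some unit vector `ν` and its orthogonal complement, the open region above the graph of a Lipschitz
function. (A Lipschitz function of the component `x - ⟪ν, x⟫ ν` orthogonal to `ν` is the same as
the restriction to that component of a Lipschitz function `γ` on the whole space.) -/
def HasLipschitzBoundary (Ω : Set E) : Prop :=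
  ∀ a ∈ frontier Ω, ∃ (ν : E) (r : ℝ) (K : NNReal) (γ : E → ℝ),
    ‖ν‖ = 1 ∧ 0 < r ∧ LipschitzWith K γ ∧
    ∀ x ∈ Metric.ball a r, (x ∈ Ω ↔ γ (x - inner ℝ ν x • ν) < inner ℝ ν x)

/-- Test functions on `Ω`, i.e. elements of `C_c^∞(Ω)`. -/
def IsTestFunction (Ω : Set E) (φ : E → ℝ) : Prop :=
  ContDiff ℝ ∞ φ ∧ HasCompactSupport φ ∧ tsupport φ ⊆ Ω

/-- `u ∈ W^{1,1}(Ω)` with weak gradient `G`. -/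
structure IsSobolev (Ω : Set E) (u : E → ℝ) (G : E → E) : Prop where
  integrable : IntegrableOn u Ω
  integrable_grad : IntegrableOn G Ω
  weak_grad : ∀ φ : E → ℝ, IsTestFunction Ω φ → ∀ v : E,
    ∫ x in Ω, u x * fderiv ℝ φ x v = - ∫ x in Ω, φ x * inner ℝ (G x) v

/-- `u ∈ W^{1,1}_0(Ω)` with weak gradient `G`: the closure of `C_c^∞(Ω)` in `W^{1,1}(Ω)`. -/
def IsSobolevZero (Ω : Set E) (u : E → ℝ) (G : E → E) : Prop :=
  IsSobolev Ω u G ∧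
  ∃ φ : ℕ → E → ℝ, (∀ j, IsTestFunction Ω (φ j)) ∧
    Tendsto (fun j => eLpNorm (fun x => φ j x - u x) 1 (volume.restrict Ω)) atTop (𝓝 0) ∧
    Tendsto (fun j => eLpNorm (fun x => gradient (φ j) x - G x) 1 (volume.restrict Ω))
      atTop (𝓝 0)

/-- The `(dim E - 1)`-dimensional Hausdorff measure on a set `S`, with the normalisation for which
it is Lebesgue measure on hyperplanes. -/
def surfaceMeasure (S : Set E) : Measure E :=
  (Measure.euclideanHausdorffMeasure (Module.finrank ℝ E - 1)).restrict S

/-- `g` is the trace on `∂Ω` of the function `u ∈ W^{1,1}(Ω)`. The trace operator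
`W^{1,1}(Ω) → L¹(∂Ω)` of a bounded Lipschitz domain is the unique continuous operator which is
restriction to `∂Ω` on `W^{1,1}(Ω) ∩ C(closure Ω)`; since this subspace is dense in `W^{1,1}(Ω)`,
`g` is the trace of `u` iff `(u, g)` is a limit of pairs `(U j, U j restricted to ∂Ω)` in
`W^{1,1}(Ω) × L¹(∂Ω)`. -/
def HasTrace (Ω : Set E) (u g : E → ℝ) : Prop :=
  Integrable g (surfaceMeasure (frontier Ω)) ∧
  ∃ G : E → E, IsSobolev Ω u G ∧
  ∃ (U : ℕ → E → ℝ) (V : ℕ → E → E),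
    (∀ j, ContinuousOn (U j) (closure Ω) ∧ IsSobolev Ω (U j) (V j)) ∧
    Tendsto (fun j => eLpNorm (fun x => U j x - u x) 1 (volume.restrict Ω)) atTop (𝓝 0) ∧
    Tendsto (fun j => eLpNorm (fun x => V j x - G x) 1 (volume.restrict Ω)) atTop (𝓝 0) ∧
    Tendsto (fun j => eLpNorm (fun x => U j x - g x) 1 (surfaceMeasure (frontier Ω)))
      atTop (𝓝 0)

end General

/-- The space `ℝ^{n_2 + ... + n_k}` of the points `(x_2, ..., x_k)`, with its Euclidean norm. The
number of blocks is `m = k - 1`, and the block `x_{i+2}` is the component with index `i : Fin m`. -/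
abbrev Rest {m : ℕ} (n : Fin m → ℕ) : Type :=
  PiLp 2 fun i : Fin m => EuclideanSpace ℝ (Fin (n i))

/-- The space `ℝ^N = ℝ^{n_1} × ℝ^{n_2 + ... + n_k}`, with its Euclidean norm. -/
abbrev Total (n₁ : ℕ) {m : ℕ} (n : Fin m → ℕ) : Type :=
  WithLp 2 (EuclideanSpace ℝ (Fin n₁) × Rest n)

variable {n₁ m : ℕ} {n : Fin m → ℕ}

/-- The product `A × B ⊆ ℝ^N`. -/
def cartesian (A : Set (EuclideanSpace ℝ (Fin n₁))) (B : Set (Rest n)) : Set (Total n₁ n) :=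
  {x | x.fst ∈ A ∧ x.snd ∈ B}

/-- The space `W_0^{1,(p_i)_{i=2}^k}(Ω₂)`. -/
def MemSobolevZeroRest (Ω₂ : Set (Rest n)) (p : Fin m → ℝ) (v : Rest n → ℝ) : Prop :=
  ∃ G : Rest n → Rest n, IsSobolevZero Ω₂ v G ∧
    ∀ i, MemLp (fun y => G y i) (ENNReal.ofReal (p i)) (volume.restrict Ω₂)

/-- `u ∈ W_{0,w}^{1,(p_i)}(Ω₁ × Ω₂)` with weak gradient `G`, where `p_1 = 1` and `p` lists
`p_2, ..., p_k`. -/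
structure IsWeakZeroSobolev (Ω₁ : Set (EuclideanSpace ℝ (Fin n₁))) (Ω₂ : Set (Rest n))
    (p : Fin m → ℝ) (u : Total n₁ n → ℝ) (G : Total n₁ n → Total n₁ n) : Prop where
  sobolev : IsSobolev (cartesian Ω₁ Ω₂) u G
  memLp_first : MemLp (fun x => (G x).fst) 1 (volume.restrict (cartesian Ω₁ Ω₂))
  memLp_rest : ∀ i, MemLp (fun x => (G x).snd i) (ENNReal.ofReal (p i))
    (volume.restrict (cartesian Ω₁ Ω₂))
  slice_zero : ∀ᵐ x₁ ∂(volume.restrict Ω₁),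
    MemSobolevZeroRest Ω₂ p fun y => u (WithLp.toLp 2 (x₁, y))

end AnisoGagliardo

end

open scoped ENNReal NNReal

noncomputable section

namespace AnisoGagliardo

/-! ### Hausdorff measure under Lipschitz maps -/

section HausdorffMeasure

variable {X Y : Type*} [MetricSpace X] [MeasurableSpace X] [BorelSpace X]
  [MetricSpace Y] [MeasurableSpace Y] [BorelSpace Y]

/-! Let `φ` be smooth with compact support over `Ω₂`. It is extended by `u = φ (1 - w)`, where `w`
vanishes on the lateral boundary and equals 1 at distance more than `2t` from the complement of the
cylinder `D = Ω₁ × ℝ^{n₂+…+n_k}`. If `w` depends on `x₁` alone, then for `i ≥ 2` the gradient in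
`x_i` is `(1 - w) ∇_{x_i} φ`: it is bounded and lives in a layer whose volume tends to 0, so it is
small in every `L^{p_i}`. The gradient in `x₁` is a similar small term minus `φ ∇w`, and everything
rests on `∫ |φ| |∇w| ≤ ∫ |φ| dℋ^{N-1} + o(1)`, with constant exactly 1.

For this, `w` is a mollified indicator of `D`. An increment of the indicator by `h v` lives on
points that cross the boundary within time `h` in direction `v`. Since orthogonal projections do not
increase Hausdorff measure, these points have volume at most `h` times the surface measure, up to
`o(h)` (`volume_sweep_le`, `setLIntegral_sweep_le`, `norm_gradient_mollifiedIndicator_le`). Only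
finiteness of the surface measure is used here, and no divergence theorem. Shifting the kernel into
the cone of the Lipschitz boundary makes `w` vanish on the boundary itself, and the translation
invariance of `D` passes to `w` (`exists_barrier`).

The cone is available only near a lateral boundary point, so the construction is local
(`exists_thin_extension_near`) and is glued by a partition of unity, which keeps the constant 1
(`exists_thin_extension`). A general `f` is a rapidly convergent telescoping series of smooth data
(`exists_thin_extension_series`). The series of extensions converges in `W^{1,1}`, and its smooth
partial sums yield the trace and the zero boundary values of the slices. -/

lemma euclideanHausdorffMeasure_image_le {f : X → Y} {K : ℝ≥0} (hf : LipschitzWith K f) (d : ℕ)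
    (S : Set X) :
    (Measure.euclideanHausdorffMeasure d : Measure Y) (f '' S) ≤
      (K : ℝ≥0∞) ^ d * (Measure.euclideanHausdorffMeasure d : Measure X) S := by
  simp only [Measure.euclideanHausdorffMeasure_def, Measure.smul_apply, ENNReal.smul_def,
    smul_eq_mul]
  rw [mul_left_comm]
  gcongr
  simpa using hf.hausdorffMeasure_image_le (d := (d : ℝ)) (by positivity) S

end HausdorffMeasure

/-! ### Volume swept out by translating a set -/

section Sweep

variable {E : Type*} [NormedAddCommGroup E] [InnerProductSpace ℝ E] [FiniteDimensional ℝ E]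

lemma finrank_orthogonal_span_unit {v : E} (hv : ‖v‖ = 1) :
    Module.finrank ℝ (ℝ ∙ v)ᗮ = Module.finrank ℝ E - 1 := by
  have h0 : v ≠ 0 := by rintro rfl; simp at hv
  have h1 := (ℝ ∙ v).finrank_add_finrank_orthogonal
  rw [finrank_span_singleton h0] at h1
  omega

/-- The set swept out by moving `S` backwards along `v` up to time `h`. -/
def sweep (v : E) (h : ℝ) (S : Set E) : Set E := {y | ∃ s ∈ Icc 0 h, y + s • v ∈ S}

variable [MeasurableSpace E] [BorelSpace E]

/-- The swept set lies in a cylinder with axis `v`: its axial extent is at most `h + 2δ`, and its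
base is the orthogonal projection of `S`, whose measure is at most that of `S` because projections
are 1-Lipschitz. -/
lemma volume_sweep_le {v : E} (hv : ‖v‖ = 1) {h δ : ℝ} {S : Set E}
    (hS : ∀ x ∈ S, ∀ y ∈ S, dist x y ≤ δ) :
    volume (sweep v h S) ≤
      ENNReal.ofReal (h + 2 * δ) *
        (Measure.euclideanHausdorffMeasure (Module.finrank ℝ E - 1) : Measure E) S := by
  rcases S.eq_empty_or_nonempty with rfl | ⟨p, hp⟩
  · simp [sweep]
  set L : Submodule ℝ E := ℝ ∙ v with hL
  let e : ℝ ≃ₗᵢ[ℝ] L := LinearIsometryEquiv.toSpanUnitSingleton v hv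
  have hmp := L.measurePreserving_measurableEquivProd p
  rw [InnerProductSpace.euclideanHausdorffMeasure_eq_volume] at hmp
  -- Relative to `p ∈ S`, the axial coordinates of `S` lie in `[-δ, δ]`; moving back by at most `h`
  -- extends the lower end only.
  let A : Set L := e '' Icc (-δ - h) δ
  let B : Set Lᗮ := (fun x => Lᗮ.orthogonalProjectionOnto (x - p)) '' S
  have hsub : sweep v h S ⊆ L.measurableEquivProd p ⁻¹' (A ×ˢ B) := by
    rintro y ⟨s, hs, hy⟩
    have hin : ∀ z : E, e (inner ℝ v z) = L.orthogonalProjectionOnto z := by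
      intro z
      apply Subtype.ext
      rw [Submodule.coe_orthogonalProjectionOnto_apply,
        Submodule.starProjection_unit_singleton ℝ hv]
      rfl
    simp only [mem_preimage, Submodule.measurableEquivProd_apply, mem_prod, vsub_eq_sub]
    constructor
    · refine ⟨inner ℝ v (y - p), ?_, hin _⟩
      have h1 : |inner ℝ v (y + s • v - p)| ≤ δ := by
        refine (abs_real_inner_le_norm _ _).trans ?_
        rw [hv, one_mul, ← dist_eq_norm]
        exact hS _ hy _ hp
      have h2 : inner ℝ v (y + s • v - p) = inner ℝ v (y - p) + s := by
        rw [show y + s • v - p = (y - p) + s • v by abel, inner_add_right, inner_smul_right,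
          real_inner_self_eq_norm_sq, hv]
        ring
      rw [h2, abs_le] at h1
      constructor <;> linarith [h1.1, h1.2, hs.1, hs.2]
    · refine ⟨y + s • v, hy, ?_⟩
      beta_reduce
      rw [show y + s • v - p = (y - p) + s • v by abel, map_add]
      have : Lᗮ.orthogonalProjectionOnto (s • v) = 0 := by
        rw [Submodule.orthogonalProjectionOnto_eq_zero_iff]
        exact L.le_orthogonal_orthogonal (L.smul_mem _ (Submodule.mem_span_singleton_self v))
      simp [this]
  calc volume (sweep v h S) ≤ volume (L.measurableEquivProd p ⁻¹' (A ×ˢ B)) := measure_mono hsub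
    _ = volume (A ×ˢ B) := hmp.measure_preimage_equiv _
    _ = volume A * volume B := by rw [Measure.volume_eq_prod, Measure.prod_prod]
    _ ≤ _ := by
      gcongr
      · have : A = e.symm ⁻¹' Icc (-δ - h) δ := e.toEquiv.image_eq_preimage_symm _
        rw [this, (LinearIsometryEquiv.measurePreserving e.symm).measure_preimage
          measurableSet_Icc.nullMeasurableSet]
        rw [Real.volume_Icc]
        gcongr
        linarith
      · rw [← finrank_orthogonal_span_unit hv, ← InnerProductSpace.euclideanHausdorffMeasure_eq_volume]
        have hl : LipschitzWith 1 (fun x => Lᗮ.orthogonalProjectionOnto (x - p)) := by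
          refine LipschitzWith.of_dist_le_mul fun x y => ?_
          rw [dist_eq_norm, ← map_sub, sub_sub_sub_cancel_right, dist_eq_norm]
          simpa using (Lᗮ.orthogonalProjectionOnto).le_of_opNorm_le
            (Submodule.orthogonalProjectionOnto_norm_le _) (x - y)
        have := euclideanHausdorffMeasure_image_le hl (Module.finrank ℝ Lᗮ) S
        rwa [ENNReal.coe_one, one_pow, one_mul] at this

end Sweep

/-- A segment avoiding the frontier would be disconnected by the interior of `D` and the complement
of its closure. -/
lemma exists_mem_frontier_of_segment {E : Type*} [NormedAddCommGroup E] [NormedSpace ℝ E]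
    {D : Set E} {y v : E} {h : ℝ} (hh : 0 ≤ h) (h0 : y ∉ D)
    (h1 : y + h • v ∈ D) : ∃ s ∈ Icc 0 h, y + s • v ∈ frontier D := by
  have hc : IsPreconnected ((fun s : ℝ => y + s • v) '' Icc 0 h) :=
    isPreconnected_Icc.image _ (by fun_prop)
  by_contra! hno
  have hne := hc (interior D) (closure D)ᶜ isOpen_interior
    isClosed_closure.isOpen_compl ?_ ⟨_, ⟨h, ⟨hh, le_rfl⟩, rfl⟩, ?_⟩ ⟨_, ⟨0, ⟨le_rfl, hh⟩, rfl⟩, ?_⟩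
  · obtain ⟨z, -, hz1, hz2⟩ := hne
    exact hz2 (subset_closure (interior_subset hz1))
  · rintro _ ⟨s, hs, rfl⟩
    by_contra hcon
    rw [mem_union, not_or, mem_compl_iff, not_not] at hcon
    exact hno s hs ⟨hcon.2, hcon.1⟩
  · by_contra hcon
    exact hno h ⟨hh, le_rfl⟩ ⟨subset_closure h1, hcon⟩
  · intro hcl
    refine hno 0 ⟨le_rfl, hh⟩ ⟨hcl, fun hcon => h0 ?_⟩
    simpa using interior_subset hcon

/-! ### Gradient bound for mollified indicator functions -/

section MollifiedIndicator

variable {E : Type*} [NormedAddCommGroup E] [InnerProductSpace ℝ E] [FiniteDimensional ℝ E]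
  [MeasurableSpace E] [BorelSpace E]

lemma exists_measurable_partition_dist_le {δ : ℝ} (hδ : 0 < δ) :
    ∃ P : ℕ → Set E, (∀ k, MeasurableSet (P k)) ∧ Pairwise (Function.onFun Disjoint P) ∧
      (⋃ k, P k) = univ ∧ ∀ k, ∀ x ∈ P k, ∀ y ∈ P k, dist x y ≤ δ := by
  let Q : ℕ → Set E := fun k => Metric.ball (TopologicalSpace.denseSeq E k) (δ / 2)
  refine ⟨disjointed Q, fun k => MeasurableSet.disjointed (fun i => measurableSet_ball) k,
    disjoint_disjointed Q, ?_, fun k x hx y hy => ?_⟩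
  · rw [iUnion_disjointed, eq_univ_iff_forall]
    intro x
    obtain ⟨k, hk⟩ := (TopologicalSpace.denseRange_denseSeq E).exists_dist_lt x (half_pos hδ)
    exact mem_iUnion.2 ⟨k, hk⟩
  · have hx' := Metric.mem_ball.1 (disjointed_subset Q k hx)
    have hy' := Metric.mem_ball'.1 (disjointed_subset Q k hy)
    linarith [dist_triangle x (TopologicalSpace.denseSeq E k) y]

/-- Cut `F` into pieces of diameter at most `δ` and apply `volume_sweep_le` to each. A point swept
by a piece is within `h + δ` of every point of that piece, so the Lipschitz bound transfers `g` to
the piece at cost `K (h + δ)`. -/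
lemma setLIntegral_sweep_le {v : E} (hv : ‖v‖ = 1) {h δ : ℝ} (hδ : 0 < δ)
    {F : Set E} (hF : MeasurableSet F) {g : E → ℝ} {K : ℝ≥0} (hg : LipschitzWith K g) :
    ∫⁻ y in sweep v h F, ENNReal.ofReal (g y) ≤
      ENNReal.ofReal (h + 2 * δ) * ∫⁻ y in F, ENNReal.ofReal (g y + K * (h + δ))
        ∂(Measure.euclideanHausdorffMeasure (Module.finrank ℝ E - 1)) := by
  obtain ⟨P, hPm, hPd, hPu, hPδ⟩ := exists_measurable_partition_dist_le (E := E) hδ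
  set μ : Measure E := Measure.euclideanHausdorffMeasure (Module.finrank ℝ E - 1)
  have hFU : F = ⋃ k, F ∩ P k := by rw [← inter_iUnion, hPu, inter_univ]
  have hsw : sweep v h F ⊆ ⋃ k, sweep v h (F ∩ P k) := by
    rintro y ⟨s, hs, hy⟩
    obtain ⟨k, hk⟩ := mem_iUnion.1 (hFU ▸ hy)
    exact mem_iUnion.2 ⟨k, s, hs, hk⟩
  have key : ∀ k, ∫⁻ y in sweep v h (F ∩ P k), ENNReal.ofReal (g y) ≤
      ENNReal.ofReal (h + 2 * δ) * ∫⁻ y in F ∩ P k, ENNReal.ofReal (g y + K * (h + δ)) ∂μ := by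
    intro k
    -- The infimum avoids choosing a point of the piece; for an empty piece it is `⊤`, but is
    -- multiplied by measure zero.
    set c : ℝ≥0∞ := ⨅ p ∈ F ∩ P k, ENNReal.ofReal (g p + K * (h + δ)) with hc
    have h1 : ∀ y ∈ sweep v h (F ∩ P k), ENNReal.ofReal (g y) ≤ c := by
      rintro y ⟨s, hs, hy⟩
      refine le_iInf₂ fun p hp => ENNReal.ofReal_le_ofReal ?_
      have h2 := hg.dist_le_mul y p
      have h3 : dist y p ≤ h + δ := by
        refine (dist_triangle y (y + s • v) p).trans (add_le_add ?_ (hPδ k _ hy.2 _ hp.2))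
        rw [dist_self_add_right, norm_smul, hv, mul_one, Real.norm_of_nonneg hs.1]
        exact hs.2
      have h4 := (Real.dist_eq _ _ ▸ h2 : |g y - g p| ≤ _)
      have h5 : (K : ℝ) * dist y p ≤ K * (h + δ) := by gcongr
      linarith [le_abs_self (g y - g p)]
    calc ∫⁻ y in sweep v h (F ∩ P k), ENNReal.ofReal (g y)
        ≤ ∫⁻ y in sweep v h (F ∩ P k), c := by
          refine lintegral_mono_ae ?_
          rw [ae_restrict_iff]
          · exact Eventually.of_forall h1
          · exact measurableSet_le hg.continuous.measurable.ennreal_ofReal measurable_const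
      _ = c * volume (sweep v h (F ∩ P k)) := by rw [lintegral_const, Measure.restrict_apply_univ]
      _ ≤ c * (ENNReal.ofReal (h + 2 * δ) * μ (F ∩ P k)) := by
          gcongr
          exact volume_sweep_le hv fun x hx y hy => hPδ k x hx.2 y hy.2
      _ = ENNReal.ofReal (h + 2 * δ) * ∫⁻ y in F ∩ P k, c ∂μ := by
          rw [lintegral_const, Measure.restrict_apply_univ]; ring
      _ ≤ _ := by
          refine mul_le_mul' le_rfl ?_
          refine setLIntegral_mono' (hF.inter (hPm k)) fun y hy => ?_
          exact iInf₂_le (f := fun p _ => ENNReal.ofReal (g p + K * (h + δ))) y hy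
  calc ∫⁻ y in sweep v h F, ENNReal.ofReal (g y)
      ≤ ∫⁻ y in ⋃ k, sweep v h (F ∩ P k), ENNReal.ofReal (g y) := lintegral_mono_set hsw
    _ ≤ ∑' k, ∫⁻ y in sweep v h (F ∩ P k), ENNReal.ofReal (g y) := lintegral_iUnion_le _ _
    _ ≤ ∑' k, ENNReal.ofReal (h + 2 * δ) *
          ∫⁻ y in F ∩ P k, ENNReal.ofReal (g y + K * (h + δ)) ∂μ := ENNReal.tsum_le_tsum key
    _ = _ := by
      rw [ENNReal.tsum_mul_left, ← lintegral_iUnion (fun k => hF.inter (hPm k)), ← hFU]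
      exact fun i j hij => (hPd hij).mono inter_subset_right inter_subset_right

/-- The mollification of the indicator function of `D` with kernel `ρ`. -/
def mollifiedIndicator (D : Set E) (ρ : E → ℝ) (x : E) : ℝ := ∫ z in D, ρ (x - z)

lemma mollifiedIndicator_eq_convolution {D : Set E} (hD : MeasurableSet D) (ρ : E → ℝ) :
    mollifiedIndicator D ρ =
      convolution (D.indicator fun _ => (1 : ℝ)) ρ (ContinuousLinearMap.mul ℝ ℝ) volume := by
  ext x
  rw [convolution_def, mollifiedIndicator, ← integral_indicator hD]
  congr 1 with z
  by_cases hz : z ∈ D <;> simp [hz]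

lemma contDiff_mollifiedIndicator {D : Set E} (hD : MeasurableSet D) {ρ : E → ℝ}
    (hρ : ContDiff ℝ ∞ ρ) (hc : HasCompactSupport ρ) : ContDiff ℝ ∞ (mollifiedIndicator D ρ) := by
  rw [mollifiedIndicator_eq_convolution hD]
  refine hc.contDiff_convolution_right _ ?_ hρ
  exact (locallyIntegrable_const 1).indicator hD

/-- After translating the variable, the difference integrates `ρ (x - ·)` against the indicator of
`D - h v` minus that of `D`, which is at most the indicator of `(D - h v) \ D`. From each point of
that set the segment of length `h` along `v` meets the frontier. Only frontier points near the
support of `ρ (x - ·)` have to lie in `F`. -/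
lemma mollifiedIndicator_diff_le {D : Set E} (hD : MeasurableSet D) {ρ : E → ℝ}
    (hρ : ContDiff ℝ ∞ ρ) (hc : HasCompactSupport ρ) (h0 : ∀ z, 0 ≤ ρ z) {x v : E}
    {h κ : ℝ} (hh : 0 ≤ h) (hhκ : h ≤ κ) (hv : ‖v‖ = 1) {F : Set E}
    (hF : ∀ y, ρ (x - y) ≠ 0 → ∀ p ∈ frontier D, dist y p ≤ κ → p ∈ F) :
    ENNReal.ofReal (mollifiedIndicator D ρ (x + h • v) - mollifiedIndicator D ρ x) ≤
      ∫⁻ y in sweep v h F, ENNReal.ofReal (ρ (x - y)) := by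
  have hi : Integrable fun y => ρ (x - y) :=
    (hρ.continuous.integrable_of_hasCompactSupport hc).comp_sub_left x
  have hD' : MeasurableSet ((fun y => y + h • v) ⁻¹' D) := hD.preimage (by fun_prop)
  have e1 : mollifiedIndicator D ρ (x + h • v) =
      ∫ y in (fun y => y + h • v) ⁻¹' D, ρ (x - y) := by
    rw [mollifiedIndicator, ← integral_indicator hD, ← integral_indicator hD',
      ← integral_add_right_eq_self _ (h • v)]
    congr 1 with y
    simp only [indicator, add_sub_add_right_eq_sub]
    rfl
  set B : Set E := (fun y => y + h • v) ⁻¹' D \ D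
  have hB : MeasurableSet B := hD'.diff hD
  have e2 : mollifiedIndicator D ρ (x + h • v) - mollifiedIndicator D ρ x ≤
      ∫ y in B, ρ (x - y) := by
    rw [e1, mollifiedIndicator, ← integral_indicator hD, ← integral_indicator hD',
      ← integral_indicator hB, ← integral_sub (hi.indicator hD') (hi.indicator hD)]
    refine integral_mono ((hi.indicator hD').sub (hi.indicator hD)) (hi.indicator hB) fun y => ?_
    have := h0 (x - y)
    by_cases h1 : y + h • v ∈ D <;> by_cases h2 : y ∈ D <;> simp [indicator, B, h1, h2, this]
  refine (ENNReal.ofReal_le_ofReal e2).trans ?_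
  rw [ofReal_integral_eq_lintegral_ofReal hi.integrableOn (Eventually.of_forall fun y => h0 _)]
  have hm : MeasurableSet {y | ρ (x - y) ≠ 0} :=
    (measurableSet_singleton (0 : ℝ)).compl.preimage (by have := hρ.continuous; fun_prop)
  have : ∫⁻ y in B, ENNReal.ofReal (ρ (x - y)) =
      ∫⁻ y in B ∩ {y | ρ (x - y) ≠ 0}, ENNReal.ofReal (ρ (x - y)) := by
    rw [← lintegral_indicator hB, ← lintegral_indicator (hB.inter hm)]
    congr 1 with y
    by_cases h1 : y ∈ B <;> by_cases h2 : ρ (x - y) = 0 <;> simp [indicator, h1, h2]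
  rw [this]
  refine lintegral_mono_set ?_
  rintro y ⟨⟨hy1, hy2⟩, hy3⟩
  obtain ⟨s, hs, hys⟩ := exists_mem_frontier_of_segment hh hy2 hy1
  refine ⟨s, hs, hF y hy3 _ hys ?_⟩
  rw [dist_self_add_right, norm_smul, hv, mul_one, Real.norm_of_nonneg hs.1]
  exact hs.2.trans hhκ

lemma fderiv_mollifiedIndicator_apply_le {D : Set E} (hD : MeasurableSet D) {ρ : E → ℝ}
    (hρ : ContDiff ℝ ∞ ρ) (hc : HasCompactSupport ρ) (h0 : ∀ z, 0 ≤ ρ z) {x v : E}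
    {κ : ℝ} (hκ : 0 < κ) (hv : ‖v‖ = 1) {F : Set E} (hFm : MeasurableSet F)
    (hFfin : (Measure.euclideanHausdorffMeasure (Module.finrank ℝ E - 1) : Measure E) F ≠ ⊤)
    (hF : ∀ y, ρ (x - y) ≠ 0 → ∀ p ∈ frontier D, dist y p ≤ κ → p ∈ F) :
    fderiv ℝ (mollifiedIndicator D ρ) x v ≤
      ∫ y in F, ρ (x - y) ∂(Measure.euclideanHausdorffMeasure (Module.finrank ℝ E - 1)) := by
  set μ : Measure E := Measure.euclideanHausdorffMeasure (Module.finrank ℝ E - 1)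
  set w := mollifiedIndicator D ρ
  obtain ⟨K, hK⟩ := (hρ.of_le (by exact_mod_cast le_top)).lipschitzWith_of_hasCompactSupport hc one_ne_zero
  have hg : LipschitzWith K fun y => ρ (x - y) := by
    have := hK.comp (LipschitzWith.of_dist_le_mul (K := 1) (f := fun y => x - y)
      (fun a b => by rw [dist_sub_left, NNReal.coe_one, one_mul]))
    simpa using! this
  have : IsFiniteMeasure (μ.restrict F) := ⟨by simpa using hFfin.lt_top⟩
  obtain ⟨M, hM⟩ := hc.exists_bound_of_continuous hρ.continuous
  have hi : Integrable (fun y => ρ (x - y)) (μ.restrict F) :=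
    Integrable.of_bound (hg.continuous.aestronglyMeasurable) M (Eventually.of_forall fun y => hM _)
  set I := ∫ y in F, ρ (x - y) ∂μ
  have key : ∀ h ∈ Ioo 0 κ, (w (x + h • v) - w x) / h ≤
      (1 + 2 * h) * (I + K * (h + h ^ 2) * (μ.restrict F).real univ) := by
    intro h hh
    -- Pieces of diameter `h ^ 2` make the factor `h + 2 h ^ 2` equal to `h` to first order, so the
    -- limit of the quotients has constant 1.
    have h1 := (mollifiedIndicator_diff_le hD hρ hc h0 hh.1.le hh.2.le hv hF).trans
      (setLIntegral_sweep_le hv (pow_pos hh.1 2) hFm hg)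
    have hn : ∀ y, 0 ≤ ρ (x - y) + K * (h + h ^ 2) := fun y => by
      have := h0 (x - y); have := hh.1; positivity
    rw [← ofReal_integral_eq_lintegral_ofReal (f := fun y => ρ (x - y) + K * (h + h ^ 2)) (hi.add (integrable_const _))
      (Eventually.of_forall hn), ← ENNReal.ofReal_mul (by nlinarith [hh.1]),
      ENNReal.ofReal_le_ofReal_iff (mul_nonneg (by nlinarith [hh.1])
        (integral_nonneg hn)), integral_add hi (integrable_const _), integral_const] at h1
    rw [div_le_iff₀ hh.1]
    refine h1.trans (le_of_eq ?_)
    simp only [smul_eq_mul]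
    ring
  have hd : HasDerivAt (fun h : ℝ => w (x + h • v)) (fderiv ℝ w x v) 0 := by
    have hw : DifferentiableAt ℝ w x :=
      (contDiff_mollifiedIndicator hD hρ hc).differentiable (by simp) x
    exact hw.hasFDerivAt.hasLineDerivAt v
  have ht := (hasDerivAt_iff_tendsto_slope.1 hd).mono_left
    (nhdsWithin_mono _ (fun h (hh : h ∈ Ioi (0 : ℝ)) => ne_of_gt hh))
  have ht2 : Tendsto (fun h : ℝ =>
      (1 + 2 * h) * (I + K * (h + h ^ 2) * (μ.restrict F).real univ)) (𝓝[>] 0) (𝓝 I) := by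
    have : Continuous fun h : ℝ =>
      (1 + 2 * h) * (I + K * (h + h ^ 2) * (μ.restrict F).real univ) := by fun_prop
    simpa using (this.tendsto 0).mono_left nhdsWithin_le_nhds
  refine le_of_tendsto_of_tendsto ht ht2 ?_
  filter_upwards [Ioo_mem_nhdsGT hκ] with h hh
  have := key h hh
  rw [slope_def_field]
  simpa using this

/-- The directional bound is the same for all unit vectors, so it may be used in the direction of
the gradient itself. -/
lemma norm_gradient_mollifiedIndicator_le {D : Set E} (hD : MeasurableSet D) {ρ : E → ℝ}
    (hρ : ContDiff ℝ ∞ ρ) (hc : HasCompactSupport ρ) (h0 : ∀ z, 0 ≤ ρ z) {x : E}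
    {κ : ℝ} (hκ : 0 < κ) {F : Set E} (hFm : MeasurableSet F)
    (hFfin : (Measure.euclideanHausdorffMeasure (Module.finrank ℝ E - 1) : Measure E) F ≠ ⊤)
    (hF : ∀ y, ρ (x - y) ≠ 0 → ∀ p ∈ frontier D, dist y p ≤ κ → p ∈ F) :
    ‖gradient (mollifiedIndicator D ρ) x‖ ≤
      ∫ y in F, ρ (x - y) ∂(Measure.euclideanHausdorffMeasure (Module.finrank ℝ E - 1)) := by
  set g := gradient (mollifiedIndicator D ρ) x with hg
  by_cases hz : g = 0
  · rw [hz, norm_zero]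
    exact integral_nonneg fun y => h0 _
  have hv : ‖(‖g‖⁻¹ • g)‖ = 1 := norm_smul_inv_norm (𝕜 := ℝ) hz
  refine le_trans (le_of_eq ?_) (fderiv_mollifiedIndicator_apply_le hD hρ hc h0 hκ hv hFm hFfin hF)
  rw [← toDual_gradient, InnerProductSpace.toDual_apply_apply, ← hg, inner_smul_right,
    real_inner_self_eq_norm_sq]
  field_simp

end MollifiedIndicator

/-! ### Cone property and finite surface measure of Lipschitz domains -/

section LipschitzBoundary

variable {E : Type*} [NormedAddCommGroup E] [InnerProductSpace ℝ E]

lemma norm_sub_inner_smul_le {ν : E} (hν : ‖ν‖ = 1) (x : E) :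
    ‖x - (inner ℝ ν x : ℝ) • ν‖ ≤ ‖x‖ := by
  have h : ‖x - (inner ℝ ν x : ℝ) • ν‖ ^ 2 = ‖x‖ ^ 2 - (inner ℝ ν x : ℝ) ^ 2 := by
    rw [norm_sub_sq_real, inner_smul_right, real_inner_comm, norm_smul, hν, mul_one,
      Real.norm_eq_abs, sq_abs, real_inner_comm]
    ring
  refine le_of_sq_le_sq ?_ (norm_nonneg x)
  rw [h]
  linarith [sq_nonneg (inner ℝ ν x : ℝ)]

/-- A displacement within `c t` of `t ν` raises the height by at least `t - c t`, while the graph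
below rises by at most `K c t`. With `c = 1 / (K + 1)` the point stays above the graph. -/
lemma HasLipschitzBoundary.exists_cone {Ω : Set E} (hΩ : HasLipschitzBoundary Ω) {a : E}
    (ha : a ∈ frontier Ω) : ∃ (ν : E) (r c : ℝ), ‖ν‖ = 1 ∧ 0 < r ∧ 0 < c ∧ c ≤ 1 ∧
      ∀ x ∈ Ω ∩ Metric.ball a r, ∀ t ∈ Ioo 0 r, ∀ z ∈ Metric.ball (t • ν) (c * t), x + z ∈ Ω := by
  obtain ⟨ν, r, K, γ, hν, hr, hγ, h⟩ := hΩ a ha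
  -- Since `‖z‖ ≤ 2 t`, a third of the radius keeps `x + z` in the ball where the graph description
  -- holds.
  refine ⟨ν, r / 3, 1 / (K + 1), hν, by positivity, by positivity, ?_, ?_⟩
  · rw [div_le_one (by positivity)]
    linarith [K.2]
  rintro x ⟨hx, hxa⟩ t ⟨ht0, htr⟩ z hz
  rw [Metric.mem_ball, dist_eq_norm] at hz hxa
  have hc1 : 1 / ((K : ℝ) + 1) * t ≤ t := by
    rw [div_mul_eq_mul_div, one_mul]
    exact div_le_self ht0.le (by linarith [K.2])
  have hzn : ‖z‖ ≤ 2 * t := by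
    calc ‖z‖ = ‖(z - t • ν) + t • ν‖ := by rw [sub_add_cancel]
      _ ≤ ‖z - t • ν‖ + ‖t • ν‖ := norm_add_le _ _
      _ ≤ t + t := by
        rw [norm_smul, hν, mul_one, Real.norm_of_nonneg ht0.le]
        linarith
      _ = _ := by ring
  have hx1 : x ∈ Metric.ball a r := by rw [Metric.mem_ball, dist_eq_norm]; linarith
  have hx2 : x + z ∈ Metric.ball a r := by
    rw [Metric.mem_ball, dist_eq_norm, show x + z - a = (x - a) + z by abel]
    linarith [norm_add_le (x - a) z]
  rw [h _ hx2]
  rw [h _ hx1] at hx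
  have h1 := hγ.dist_le_mul (x + z - (inner ℝ ν (x + z) : ℝ) • ν) (x - (inner ℝ ν x : ℝ) • ν)
  have h2 : x + z - (inner ℝ ν (x + z) : ℝ) • ν - (x - (inner ℝ ν x : ℝ) • ν) =
      (z - t • ν) - (inner ℝ ν (z - t • ν) : ℝ) • ν := by
    rw [inner_add_right, inner_sub_right, inner_smul_right, real_inner_self_eq_norm_sq, hν]
    module
  rw [dist_eq_norm (x + z - _), h2, Real.dist_eq] at h1
  have h3 := norm_sub_inner_smul_le hν (z - t • ν)
  have h4 : |inner ℝ ν (z - t • ν)| ≤ ‖z - t • ν‖ := by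
    simpa [hν] using abs_real_inner_le_norm ν (z - t • ν)
  have h5 : inner ℝ ν (z - t • ν) = inner ℝ ν z - t := by
    rw [inner_sub_right, inner_smul_right, real_inner_self_eq_norm_sq, hν]; ring
  rw [h5] at h4
  have h6 : (K : ℝ) * ‖z - t • ν - (inner ℝ ν (z - t • ν) : ℝ) • ν‖ ≤ K * ‖z - t • ν‖ := by gcongr
  have h7 : (K + 1) * ‖z - t • ν‖ ≤ t := by
    have : (K + 1) * ‖z - t • ν‖ ≤ ((K : ℝ) + 1) * (1 / (K + 1) * t) := by gcongr
    refine this.trans (le_of_eq ?_)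
    field_simp
  rw [inner_add_right]
  have := le_abs_self (γ (x + z - (inner ℝ ν (x + z) : ℝ) • ν) - γ (x - (inner ℝ ν x : ℝ) • ν))
  have := (abs_le.1 h4).1
  rw [inner_add_right] at *
  linarith

variable [FiniteDimensional ℝ E] [MeasurableSpace E] [BorelSpace E]

/-- Near each of its points the frontier lies in the image of a ball of the hyperplane under the
Lipschitz map `p ↦ p + γ p • ν`; compactness does the rest. -/
lemma HasLipschitzBoundary.hausdorffMeasure_frontier_lt_top {Ω : Set E}
    (hΩ : HasLipschitzBoundary Ω) (hb : Bornology.IsBounded Ω) :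
    (Measure.euclideanHausdorffMeasure (Module.finrank ℝ E - 1) : Measure E) (frontier Ω) < ⊤ := by
  have hcomp : IsCompact (frontier Ω) :=
    Metric.isCompact_of_isClosed_isBounded isClosed_frontier
      (hb.closure.subset frontier_subset_closure)
  refine hcomp.measure_lt_top_of_nhdsWithin fun a ha => ?_
  obtain ⟨ν, r, K, γ, hν, hr, hγ, h⟩ := hΩ a ha
  refine ⟨frontier Ω ∩ Metric.ball a r,
    inter_mem_nhdsWithin _ (Metric.ball_mem_nhds a hr), ?_⟩
  set L : Submodule ℝ E := ℝ ∙ ν with hL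
  let Φ : Lᗮ → E := fun p => p + γ p • ν
  have hΦ : LipschitzWith (1 + K) Φ := by
    refine LipschitzWith.add (LipschitzWith.subtype_val _) ?_
    have h1 : LipschitzWith K fun p : Lᗮ => γ p := by
      simpa using! hγ.comp (LipschitzWith.subtype_val (Lᗮ : Set E))
    refine LipschitzWith.of_dist_le_mul fun p q => ?_
    rw [dist_eq_norm, ← sub_smul, norm_smul, hν, mul_one, ← dist_eq_norm]
    exact h1.dist_le_mul p q
  have hproj : ∀ x : E, (Lᗮ.orthogonalProjectionOnto x : E) = x - (inner ℝ ν x : ℝ) • ν := by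
    intro x
    rw [← Submodule.starProjection_unit_singleton ℝ hν, Submodule.coe_orthogonalProjectionOnto_apply]
    exact eq_sub_of_add_eq' (L.starProjection_add_starProjection_orthogonal x)
  have hcont : Continuous fun x : E => (inner ℝ ν x : ℝ) - γ (x - (inner ℝ ν x : ℝ) • ν) := by
    have := hγ.continuous
    fun_prop
  have hsub : frontier Ω ∩ Metric.ball a r ⊆
      Φ '' Metric.closedBall (Lᗮ.orthogonalProjectionOnto a) r := by
    rintro x ⟨hx, hxr⟩
    refine ⟨Lᗮ.orthogonalProjectionOnto x, ?_, ?_⟩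
    · rw [Metric.mem_closedBall, dist_eq_norm, ← map_sub]
      refine (Submodule.norm_orthogonalProjectionOnto_apply_le _ _).trans ?_
      rw [← dist_eq_norm]
      exact (Metric.mem_ball.1 hxr).le
    -- Lying strictly above or strictly below the graph is an open condition, so a frontier point
    -- does neither.
    · have hgr : γ (x - (inner ℝ ν x : ℝ) • ν) = inner ℝ ν x := by
        rcases lt_trichotomy (γ (x - (inner ℝ ν x : ℝ) • ν)) (inner ℝ ν x) with hlt | heq | hgt
        · exfalso
          refine hx.2 (mem_interior_iff_mem_nhds.2 ?_)
          filter_upwards [Metric.isOpen_ball.mem_nhds hxr,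
            (hcont.tendsto x).eventually (lt_mem_nhds (sub_pos.2 hlt))] with y hy1 hy2
          exact (h y hy1).2 (sub_pos.1 hy2)
        · exact heq
        · exfalso
          refine (mem_closure_iff_nhds.1 hx.1 {y | y ∉ Ω} ?_).elim fun y hy => hy.1 hy.2
          filter_upwards [Metric.isOpen_ball.mem_nhds hxr,
            (hcont.tendsto x).eventually (gt_mem_nhds (sub_neg.2 hgt))] with y hy1 hy2
          rw [h y hy1]
          exact not_lt.2 (sub_neg.1 hy2).le
      simp only [Φ]
      rw [hproj, hgr, sub_add_cancel]
  refine (measure_mono hsub).trans_lt ((euclideanHausdorffMeasure_image_le hΦ _ _).trans_lt ?_)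
  refine ENNReal.mul_lt_top (ENNReal.pow_lt_top ENNReal.coe_lt_top) ?_
  rw [← finrank_orthogonal_span_unit hν, InnerProductSpace.euclideanHausdorffMeasure_eq_volume]
  exact (isCompact_closedBall _ _).measure_lt_top

end LipschitzBoundary

/-! ### Barrier functions -/

section Barrier

variable {E : Type*} [NormedAddCommGroup E] [InnerProductSpace ℝ E] [FiniteDimensional ℝ E]
  [MeasurableSpace E] [BorelSpace E]

lemma mollifiedIndicator_add_of_invariant (D : Set E) (ρ : E → ℝ) {e : E}
    (he : ∀ x, x + e ∈ D ↔ x ∈ D) (x : E) :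
    mollifiedIndicator D ρ (x + e) = mollifiedIndicator D ρ x := by
  have hmp : MeasurePreserving (fun y : E => y + e) := measurePreserving_add_right volume e
  have := hmp.setIntegral_preimage_emb (measurableEmbedding_addRight e) (fun z => ρ (x + e - z)) D
  rw [mollifiedIndicator, ← this, mollifiedIndicator]
  have hD : (fun y : E => y + e) ⁻¹' D = D := by ext y; exact he y
  simp [hD]

/-- Smoothed indicator functions of an open set `D` which is invariant, near `a`, under small
translations in a cone: they vanish on the boundary near `a`, and their gradients do not have more
mass than the surface measure of the boundary. -/
lemma exists_barrier {D : Set E} (hD : IsOpen D) {a ν : E} {r c t : ℝ} (hν : ‖ν‖ = 1) (hc : 0 < c)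
    (hc1 : c ≤ 1)
    (hcone : ∀ x ∈ D ∩ Metric.ball a r, ∀ t ∈ Ioo 0 r, ∀ z ∈ Metric.ball (t • ν) (c * t), x + z ∈ D)
    (ht : t ∈ Ioo 0 r) :
    ∃ w : E → ℝ, ContDiff ℝ ∞ w ∧ (∀ x, 0 ≤ w x) ∧ (∀ x, w x ≤ 1) ∧
      (∀ x ∈ Metric.ball a (r - 2 * t), x ∉ D → w x = 0) ∧
      (∀ x, Metric.ball x (2 * t) ⊆ D → w x = 1) ∧
      (∀ e, (∀ x, x + e ∈ D ↔ x ∈ D) → ∀ x, w (x + e) = w x) ∧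
      ∀ (φ : E → ℝ) (K : ℝ≥0) (F : Set E), Continuous φ → LipschitzWith K φ → MeasurableSet F →
        (Measure.euclideanHausdorffMeasure (Module.finrank ℝ E - 1) : Measure E) F ≠ ⊤ →
        (∀ x, φ x ≠ 0 → ∀ p ∈ frontier D, dist x p ≤ 3 * t → p ∈ F) →
        ∫⁻ x, ‖φ x‖ₑ * ‖gradient w x‖ₑ ≤
          ∫⁻ y in F, (‖φ y‖ₑ + ENNReal.ofReal (K * (2 * t)))
            ∂(Measure.euclideanHausdorffMeasure (Module.finrank ℝ E - 1)) := by
  have ht0 := ht.1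
  -- The kernel sits in the cone: if `ρ (x - z) ≠ 0` with `z ∈ D` near `a`, then `x = z + (x - z) ∈
  -- D`. Hence the mollification vanishes outside `D` near `a`. As `c ≤ 1`, the kernel reaches less
  -- than `2 t` from the origin.
  let B : ContDiffBump (t • ν) := ⟨c * t / 2, c * t, by positivity, by linarith [mul_pos hc ht0]⟩
  set ρ : E → ℝ := B.normed volume with hρdef
  have hρ : ContDiff ℝ ∞ ρ := B.contDiff_normed
  have hρc : HasCompactSupport ρ := B.hasCompactSupport_normed
  have hρ0 : ∀ z, 0 ≤ ρ z := B.nonneg_normed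
  have hρi : Integrable ρ := B.integrable_normed
  have hρs : ∀ z, ρ z ≠ 0 → z ∈ Metric.ball (t • ν) (c * t) := fun z hz => by
    have : Function.support ρ = Metric.ball (t • ν) B.rOut := B.support_normed_eq
    exact this ▸ hz
  have hρn : ∀ z, ρ z ≠ 0 → ‖z‖ < 2 * t := fun z hz => by
    have h1 := hρs z hz
    rw [Metric.mem_ball, dist_eq_norm] at h1
    calc ‖z‖ = ‖(z - t • ν) + t • ν‖ := by rw [sub_add_cancel]
      _ ≤ ‖z - t • ν‖ + ‖t • ν‖ := norm_add_le _ _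
      _ < 1 * t + t := by
        rw [norm_smul, hν, mul_one, Real.norm_of_nonneg ht0.le]
        gcongr
        exact h1.trans_le (by gcongr)
      _ = _ := by ring
  have hρ1 : ∀ x, ∫ z, ρ (x - z) = 1 := fun x => by
    rw [integral_sub_left_eq_self]; exact B.integral_normed
  refine ⟨mollifiedIndicator D ρ, contDiff_mollifiedIndicator hD.measurableSet hρ hρc,
    fun x => integral_nonneg fun z => hρ0 _, fun x => ?_, fun x hx hxD => ?_, fun x hx => ?_,
    fun e he x => mollifiedIndicator_add_of_invariant D ρ he x, ?_⟩
  · rw [← hρ1 x]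
    exact setIntegral_le_integral (hρi.comp_sub_left x) (Eventually.of_forall fun z => hρ0 _)
  · rw [mollifiedIndicator]
    refine setIntegral_eq_zero_of_forall_eq_zero fun z hz => ?_
    by_contra hne
    refine hxD ?_
    have hza : z ∈ Metric.ball a r := by
      have h1 := hρn _ hne
      rw [Metric.mem_ball] at hx ⊢
      rw [← dist_eq_norm, dist_comm] at h1
      linarith [dist_triangle z x a]
    simpa using hcone z ⟨hz, hza⟩ t ht (x - z) (hρs _ hne)
  · rw [mollifiedIndicator, ← hρ1 x]
    refine setIntegral_eq_integral_of_forall_compl_eq_zero fun z hz => ?_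
    by_contra hne
    refine hz (hx ?_)
    rw [Metric.mem_ball, dist_comm, dist_eq_norm]
    exact hρn _ hne
  · intro φ K F hφc hφ hFm hFfin hF
    set μ : Measure E := Measure.euclideanHausdorffMeasure (Module.finrank ℝ E - 1)
    have : IsFiniteMeasure (μ.restrict F) := ⟨by simpa using hFfin.lt_top⟩
    have hρm : Measurable ρ := hρ.continuous.measurable
    have hφm : Measurable φ := hφc.measurable
    have hgrad : ∀ x, φ x ≠ 0 → ‖gradient (mollifiedIndicator D ρ) x‖ₑ ≤
        ∫⁻ y in F, ENNReal.ofReal (ρ (x - y)) ∂μ := by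
      intro x hx
      -- The distance `3 t` is the reach `2 t` of the kernel plus the allowed increment `κ = t`.
      have h1 := norm_gradient_mollifiedIndicator_le hD.measurableSet hρ hρc hρ0 ht0 hFm hFfin
        (x := x) (fun y hy p hp hyp => hF x hx p hp (by
          have := hρn _ hy
          rw [← dist_eq_norm] at this
          linarith [dist_triangle x y p]))
      obtain ⟨M, hM⟩ := hρc.exists_bound_of_continuous hρ.continuous
      rw [← ofReal_norm, ← ofReal_integral_eq_lintegral_ofReal
        (Integrable.of_bound (by fun_prop) M (Eventually.of_forall fun y => hM _))
        (Eventually.of_forall fun y => hρ0 _)]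
      exact ENNReal.ofReal_le_ofReal h1
    -- Tonelli moves the integration onto `F`; on the support of the kernel `|φ x| ≤ |φ y| + K (2
    -- t)`, and the kernel has integral 1.
    calc ∫⁻ x, ‖φ x‖ₑ * ‖gradient (mollifiedIndicator D ρ) x‖ₑ
        ≤ ∫⁻ x, ∫⁻ y in F, ‖φ x‖ₑ * ENNReal.ofReal (ρ (x - y)) ∂μ := by
          refine lintegral_mono fun x => ?_
          rw [lintegral_const_mul _ (by fun_prop)]
          by_cases hx : φ x = 0
          · simp [hx]
          · gcongr
            exact hgrad x hx
      _ = ∫⁻ y in F, (∫⁻ x, ‖φ x‖ₑ * ENNReal.ofReal (ρ (x - y))) ∂μ := by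
          rw [lintegral_lintegral_swap]
          fun_prop
      _ ≤ _ := by
          refine lintegral_mono fun y => ?_
          have h2 : ∀ x, ‖φ x‖ₑ * ENNReal.ofReal (ρ (x - y)) ≤
              (‖φ y‖ₑ + ENNReal.ofReal (K * (2 * t))) * ENNReal.ofReal (ρ (x - y)) := by
            intro x
            by_cases hxy : ρ (x - y) = 0
            · simp [hxy]
            · gcongr
              rw [← ofReal_norm, ← ofReal_norm, ← ENNReal.ofReal_add (norm_nonneg _) (by positivity)]
              refine ENNReal.ofReal_le_ofReal ?_
              have h3 := hφ.dist_le_mul x y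
              have h4 := hρn _ hxy
              rw [← dist_eq_norm] at h4
              have h5 : (K : ℝ) * dist x y ≤ K * (2 * t) := by gcongr
              rw [dist_eq_norm] at h3
              linarith [norm_le_norm_add_norm_sub' (φ x) (φ y)]
          refine (lintegral_mono h2).trans ?_
          rw [lintegral_const_mul _ (by fun_prop), ← ofReal_integral_eq_lintegral_ofReal
            (hρi.comp_sub_right y) (Eventually.of_forall fun y => hρ0 _),
            integral_sub_right_eq_self, B.integral_normed]
          simp

end Barrier

/-! ### Gradients of smooth functions -/

section Gradient

variable {E : Type*} [NormedAddCommGroup E] [InnerProductSpace ℝ E] [CompleteSpace E]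

lemma continuous_gradient {u : E → ℝ} (hu : ContDiff ℝ ∞ u) : Continuous (gradient u) :=
  (InnerProductSpace.toDual ℝ E).symm.continuous.comp (hu.continuous_fderiv (by simp))

lemma hasCompactSupport_gradient {u : E → ℝ} (hu : HasCompactSupport u) :
    HasCompactSupport (gradient u) :=
  (hu.fderiv ℝ).comp_left (g := (InnerProductSpace.toDual ℝ E).symm) (map_zero _)

lemma gradient_add_eq {u v : E → ℝ} {x : E} (hu : DifferentiableAt ℝ u x)
    (hv : DifferentiableAt ℝ v x) :
    gradient (fun y => u y + v y) x = gradient u x + gradient v x := by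
  simp only [gradient]
  rw [fderiv_fun_add hu hv, map_add]

lemma gradient_mul_one_sub {φ w : E → ℝ} {x : E} (hφ : DifferentiableAt ℝ φ x)
    (hw : DifferentiableAt ℝ w x) :
    gradient (fun y => φ y * (1 - w y)) x = (1 - w x) • gradient φ x - φ x • gradient w x := by
  refine ext_inner_right ℝ fun z => ?_
  rw [inner_gradient_left, fderiv_fun_mul hφ (hw.const_sub 1), fderiv_const_sub, inner_sub_left,
    real_inner_smul_left, real_inner_smul_left, inner_gradient_left, inner_gradient_left]
  simp
  ring

end Gradient

/-! ### Product domains and thin extensions -/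

section Product

variable {n₁ m : ℕ} {n : Fin m → ℕ}

lemma cartesian_eq_preimage (A : Set (EuclideanSpace ℝ (Fin n₁))) (B : Set (Rest n)) :
    cartesian A B = WithLp.homeomorphProd 2 _ _ ⁻¹' (A ×ˢ B) := rfl

lemma isOpen_cartesian {A : Set (EuclideanSpace ℝ (Fin n₁))} {B : Set (Rest n)} (hA : IsOpen A)
    (hB : IsOpen B) : IsOpen (cartesian A B) :=
  (hA.preimage (WithLp.continuous_fst _ _ _)).inter (hB.preimage (WithLp.continuous_snd _ _ _))

lemma measurableSet_cartesian {A : Set (EuclideanSpace ℝ (Fin n₁))} {B : Set (Rest n)}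
    (hA : MeasurableSet A) (hB : MeasurableSet B) : MeasurableSet (cartesian A B) :=
  (hA.preimage (WithLp.continuous_fst _ _ _).measurable).inter
    (hB.preimage (WithLp.continuous_snd _ _ _).measurable)

lemma isBounded_cartesian {A : Set (EuclideanSpace ℝ (Fin n₁))} {B : Set (Rest n)}
    (hA : Bornology.IsBounded A) (hB : Bornology.IsBounded B) :
    Bornology.IsBounded (cartesian A B) := by
  obtain ⟨C, hC⟩ := hA.exists_norm_le
  obtain ⟨D, hD⟩ := hB.exists_norm_le
  refine isBounded_iff_forall_norm_le.2 ⟨C + D, fun x hx => ?_⟩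
  have h1 := hC _ hx.1
  have h2 := hD _ hx.2
  have h3 := WithLp.prod_norm_sq_eq_of_L2 x
  have h4 := norm_nonneg x.fst
  have h5 := norm_nonneg x.snd
  refine le_trans (abs_le_of_sq_le_sq' (b := ‖x.fst‖ + ‖x.snd‖) ?_ (by positivity)).2 (by linarith)
  nlinarith

lemma frontier_cartesian (A : Set (EuclideanSpace ℝ (Fin n₁))) (B : Set (Rest n)) :
    frontier (cartesian A B) =
      cartesian (closure A) (frontier B) ∪ cartesian (frontier A) (closure B) := by
  rw [cartesian_eq_preimage, ← Homeomorph.preimage_frontier, frontier_prod_eq]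
  rfl

lemma frontier_cartesian_univ (A : Set (EuclideanSpace ℝ (Fin n₁))) :
    frontier (cartesian A (univ : Set (Rest n))) = cartesian (frontier A) univ := by
  rw [frontier_cartesian, frontier_univ, closure_univ]
  ext x
  simp [cartesian]

lemma lateral_subset_frontier (A : Set (EuclideanSpace ℝ (Fin n₁))) (B : Set (Rest n)) :
    cartesian (frontier A) B ⊆ frontier (cartesian A B) := by
  rw [frontier_cartesian]
  exact fun x hx => Or.inr ⟨hx.1, subset_closure hx.2⟩

/-- `u` is a smooth extension of `φ` from the lateral boundary `∂Ω₁ × Ω₂` into `Ω₁ × Ω₂`,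
concentrated near the lateral boundary, whose gradient in the first variable has mass at most `A`
and whose other norms are at most `δ`. -/
structure IsThinExtension (Ω₁ : Set (EuclideanSpace ℝ (Fin n₁))) (Ω₂ : Set (Rest n))
    (p : Fin m → ℝ) (ε : ℝ) (φ u : Total n₁ n → ℝ) (A δ : ℝ≥0∞) : Prop where
  contDiff : ContDiff ℝ ∞ u
  hasCompactSupport : HasCompactSupport u
  tsupport_subset : tsupport u ⊆ {x | x.snd ∈ Ω₂}
  eq_lateral : ∀ x ∈ cartesian (frontier Ω₁) Ω₂, u x = φ x
  mem_cthickening : ∀ x ∈ cartesian Ω₁ Ω₂, u x ≠ 0 →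
    x ∈ Metric.cthickening ε (cartesian (frontier Ω₁) Ω₂)
  lintegral_le : ∫⁻ x in cartesian Ω₁ Ω₂, ‖u x‖ₑ ≤ δ
  lintegral_fst_le : ∫⁻ x in cartesian Ω₁ Ω₂, ‖(gradient u x).fst‖ₑ ≤ A
  lintegral_snd_le : ∫⁻ x in cartesian Ω₁ Ω₂, ‖(gradient u x).snd‖ₑ ≤ δ
  eLpNorm_snd_le : ∀ i, eLpNorm (fun x => (gradient u x).snd i) (ENNReal.ofReal (p i))
    (volume.restrict (cartesian Ω₁ Ω₂)) ≤ δ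

variable {Ω₁ : Set (EuclideanSpace ℝ (Fin n₁))} {Ω₂ : Set (Rest n)} {p : Fin m → ℝ} {ε : ℝ}

lemma IsThinExtension.zero (A δ : ℝ≥0∞) :
    IsThinExtension Ω₁ Ω₂ p ε (fun _ => 0) (fun _ => 0) A δ := by
  have hg : gradient (fun _ : Total n₁ n => (0 : ℝ)) = fun _ => 0 := by
    ext1 x; exact gradient_fun_const x 0
  refine ⟨contDiff_const, HasCompactSupport.zero, ?_, fun _ _ => rfl, fun _ _ h => (h rfl).elim,
    ?_, ?_, ?_, ?_⟩
  · rw [show (fun _ : Total n₁ n => (0 : ℝ)) = 0 from rfl, tsupport_zero]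
    exact empty_subset _
  all_goals simp [hg]

lemma IsThinExtension.add (hp : ∀ i, 1 < p i) {φ φ' u u' : Total n₁ n → ℝ} {A A' δ δ' : ℝ≥0∞}
    (h : IsThinExtension Ω₁ Ω₂ p ε φ u A δ) (h' : IsThinExtension Ω₁ Ω₂ p ε φ' u' A' δ') :
    IsThinExtension Ω₁ Ω₂ p ε (fun x => φ x + φ' x) (fun x => u x + u' x) (A + A') (δ + δ') := by
  have hg : gradient (fun x => u x + u' x) = fun x => gradient u x + gradient u' x := by
    ext1 x
    exact gradient_add_eq (h.contDiff.differentiable (by simp) x)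
      (h'.contDiff.differentiable (by simp) x)
  have hc := continuous_gradient h.contDiff
  have hc' := continuous_gradient h'.contDiff
  have hfst := WithLp.continuous_fst 2 (EuclideanSpace ℝ (Fin n₁)) (Rest n)
  have hsnd := WithLp.continuous_snd 2 (EuclideanSpace ℝ (Fin n₁)) (Rest n)
  have huc := h.contDiff.continuous
  have hfm : Measurable fun x => ‖(gradient u x).fst‖ₑ := (hfst.comp hc).enorm.measurable
  have hsm : Measurable fun x => ‖(gradient u x).snd‖ₑ := (hsnd.comp hc).enorm.measurable
  refine ⟨h.contDiff.add h'.contDiff, h.hasCompactSupport.add h'.hasCompactSupport, ?_, ?_, ?_,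
    ?_, ?_, ?_, ?_⟩
  · exact (tsupport_add u u').trans (union_subset h.tsupport_subset h'.tsupport_subset)
  · intro x hx
    rw [h.eq_lateral x hx, h'.eq_lateral x hx]
  · intro x hx hne
    by_cases h0 : u x = 0
    · exact h'.mem_cthickening x hx fun h1 => hne (by rw [h0, h1, add_zero])
    · exact h.mem_cthickening x hx h0
  · refine (lintegral_mono fun x => enorm_add_le (u x) (u' x)).trans ?_
    rw [lintegral_add_left (by fun_prop)]
    exact add_le_add h.lintegral_le h'.lintegral_le
  · rw [hg]
    refine (lintegral_mono fun x => enorm_add_le (gradient u x).fst (gradient u' x).fst).trans ?_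
    rw [lintegral_add_left hfm]
    exact add_le_add h.lintegral_fst_le h'.lintegral_fst_le
  · rw [hg]
    refine (lintegral_mono fun x => enorm_add_le (gradient u x).snd (gradient u' x).snd).trans ?_
    rw [lintegral_add_left hsm]
    exact add_le_add h.lintegral_snd_le h'.lintegral_snd_le
  · intro i
    rw [hg]
    have hi : Continuous fun y : Rest n => y i := PiLp.continuous_apply 2 _ i
    refine le_trans (eLpNorm_add_le (f := fun x => (gradient u x).snd i)
      (g := fun x => (gradient u' x).snd i) ?_ ?_ ?_)
      (add_le_add (h.eLpNorm_snd_le i) (h'.eLpNorm_snd_le i))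
    · exact (hi.comp (hsnd.comp hc)).aestronglyMeasurable
    · exact (hi.comp (hsnd.comp hc')).aestronglyMeasurable
    · rw [← ENNReal.ofReal_one]
      exact ENNReal.ofReal_le_ofReal (hp i).le

lemma IsThinExtension.sum (hp : ∀ i, 1 < p i) {ι : Type*} (s : Finset ι)
    {φ u : ι → Total n₁ n → ℝ} {A δ : ι → ℝ≥0∞}
    (h : ∀ i ∈ s, IsThinExtension Ω₁ Ω₂ p ε (φ i) (u i) (A i) (δ i)) :
    IsThinExtension Ω₁ Ω₂ p ε (fun x => ∑ i ∈ s, φ i x) (fun x => ∑ i ∈ s, u i x)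
      (∑ i ∈ s, A i) (∑ i ∈ s, δ i) := by
  classical
  induction s using Finset.induction_on with
  | empty => simpa using IsThinExtension.zero 0 0
  | insert i s hi ih =>
    simp only [Finset.sum_insert hi]
    exact (h i (Finset.mem_insert_self i s)).add hp
      (ih fun j hj => h j (Finset.mem_insert_of_mem hj))

/-- This removes `∇w` from the derivatives of `φ (1 - w)` in `x₂, …, x_k`; a gradient of order `1 /
t` in a layer of width `t` would not be small in `L^{p_i}` for `p_i > 1`. -/
lemma snd_gradient_eq_zero_of_invariant {w : Total n₁ n → ℝ} (hw : Differentiable ℝ w)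
    (hinv : ∀ (y : Rest n) x, w (x + WithLp.toLp 2 (0, y)) = w x) (x : Total n₁ n) :
    (gradient w x).snd = 0 := by
  refine ext_inner_right ℝ fun z => ?_
  have h1 : inner ℝ (gradient w x) (WithLp.toLp 2 (0, z)) = inner ℝ (gradient w x).snd z := by
    rw [WithLp.prod_inner_apply]
    simp
  rw [← h1, inner_gradient_left, inner_zero_left]
  have h2 : HasDerivAt (fun t : ℝ => w (x + t • WithLp.toLp 2 (0, z)))
      (fderiv ℝ w x (WithLp.toLp 2 (0, z))) 0 := (hw x).hasFDerivAt.hasLineDerivAt _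
  have h3 : (fun t : ℝ => w (x + t • WithLp.toLp 2 (0, z))) = fun _ => w x := by
    ext t
    rw [← hinv (t • z) x, ← WithLp.toLp_smul, Prod.smul_mk, smul_zero]
  rw [h3] at h2
  exact h2.unique (hasDerivAt_const _ _)

end Product

/-! ### Extension of smooth data near a lateral boundary point -/

section LocalExtension

variable {n₁ m : ℕ} {n : Fin m → ℕ} {Ω₁ : Set (EuclideanSpace ℝ (Fin n₁))} {Ω₂ : Set (Rest n)}
  {p : Fin m → ℝ} {ε : ℝ}

lemma tendsto_volume_inter_cthickening_compl {E : Type*} [NormedAddCommGroup E]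
    [InnerProductSpace ℝ E] [FiniteDimensional ℝ E] [MeasurableSpace E] [BorelSpace E]
    {D Ω : Set E} (hD : IsOpen D) (hΩD : Ω ⊆ D) (hb : Bornology.IsBounded Ω) :
    Tendsto (fun t : ℝ => volume.restrict Ω (Metric.cthickening (2 * t) Dᶜ)) (𝓝[>] 0) (𝓝 0) := by
  have : IsFiniteMeasure (volume.restrict Ω) := ⟨by simpa using hb.measure_lt_top⟩
  have h1 := tendsto_measure_cthickening_of_isClosed (μ := volume.restrict Ω)
    ⟨1, one_pos, measure_ne_top _ _⟩ hD.isClosed_compl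
  have h0 : volume.restrict Ω Dᶜ = 0 := by
    rw [Measure.restrict_apply hD.isClosed_compl.measurableSet]
    rw [show Dᶜ ∩ Ω = ∅ from eq_empty_of_forall_notMem fun x hx => hx.1 (hΩD hx.2)]
    exact measure_empty
  rw [h0] at h1
  have h2 : Tendsto (fun t : ℝ => 2 * t) (𝓝[>] 0) (𝓝 0) := by
    have : Continuous fun t : ℝ => 2 * t := by fun_prop
    simpa using (this.tendsto 0).mono_left nhdsWithin_le_nhds
  exact h1.comp h2

/-- The segment from a nearby point outside the cylinder to `x` crosses its frontier. Keeping the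
first component of the crossing point and the second component of `x` gives a lateral point that is
no farther away. -/
lemma mem_cthickening_lateral_of_not_ball_subset {x : Total n₁ n} {t : ℝ} (htε : 2 * t ≤ ε)
    (hx : x.snd ∈ Ω₂) (hx1 : x.fst ∈ Ω₁)
    (hball : ¬ Metric.ball x (2 * t) ⊆ cartesian Ω₁ (univ : Set (Rest n))) :
    x ∈ Metric.cthickening ε (cartesian (frontier Ω₁) Ω₂) := by
  obtain ⟨y, hy, hyD⟩ := not_subset.1 hball
  obtain ⟨s, hs, hsf⟩ := exists_mem_frontier_of_segment (D := cartesian Ω₁ (univ : Set (Rest n)))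
    (y := y) (v := x - y) zero_le_one hyD (by simpa [cartesian] using hx1)
  rw [frontier_cartesian_univ] at hsf
  set q := y + s • (x - y)
  refine Metric.mem_cthickening_of_dist_le x (WithLp.toLp 2 (q.fst, x.snd)) ε _ ⟨hsf.1, hx⟩ ?_
  have h1 : dist x (WithLp.toLp 2 (q.fst, x.snd)) = ‖(x - q).fst‖ := by
    rw [dist_eq_norm, show x - WithLp.toLp 2 (q.fst, x.snd) = WithLp.toLp 2 ((x - q).fst, 0) by
      apply WithLp.ofLp_injective; ext1 <;> simp [q], WithLp.norm_toLp_fst]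
  rw [h1]
  refine (WithLp.norm_fst_le _ _).trans ?_
  rw [show x - q = (1 - s) • (x - y) by simp only [q]; module, norm_smul,
    Real.norm_of_nonneg (by linarith [hs.2]), ← dist_eq_norm]
  have h2 := Metric.mem_ball'.1 hy
  nlinarith [hs.1, hs.2, dist_nonneg (x := x) (y := y)]

/-- The extension is `φ (1 - w)` with `w` the barrier of the cylinder and `t` small. The radius `R`
depends neither on `φ` nor on `δ`, so a partition of unity can be chosen before the extensions. -/
lemma exists_thin_extension_near (hΩ₁ : IsOpen Ω₁) (hΩ₂ : IsOpen Ω₂)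
    (hb₁ : Bornology.IsBounded Ω₁) (hb₂ : Bornology.IsBounded Ω₂)
    (hLip : HasLipschitzBoundary (cartesian Ω₁ Ω₂)) (hp : ∀ i, 1 < p i) (hε : 0 < ε)
    {a : Total n₁ n} (ha : a ∈ cartesian (frontier Ω₁) Ω₂) :
    ∃ R > 0, ∀ φ : Total n₁ n → ℝ, ContDiff ℝ ∞ φ → HasCompactSupport φ →
      tsupport φ ⊆ Metric.ball a R → ∀ δ : ℝ≥0∞, δ ≠ 0 →
      ∃ u, IsThinExtension Ω₁ Ω₂ p ε φ u
        (∫⁻ x, ‖φ x‖ₑ ∂(surfaceMeasure (cartesian (frontier Ω₁) Ω₂)) + δ) δ := by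
  obtain ⟨ν, r₀, c, hν, hr₀, hc, hc1, hcone₀⟩ := hLip.exists_cone (lateral_subset_frontier _ _ ha)
  obtain ⟨r₁, hr₁, hball⟩ := Metric.isOpen_iff.1
    (hΩ₂.preimage (WithLp.continuous_snd 2 (EuclideanSpace ℝ (Fin n₁)) (Rest n))) a ha.2
  -- In this ball `D` and `Ω` coincide, so the cone property of `Ω` at `a` is one of `D`.
  set r := min r₀ r₁ with hr
  have hr0 : 0 < r := lt_min hr₀ hr₁
  have hballr : ∀ x ∈ Metric.ball a r, x.snd ∈ Ω₂ := fun x hx =>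
    hball (Metric.ball_subset_ball (min_le_right _ _) hx)
  set D : Set (Total n₁ n) := cartesian Ω₁ univ with hDdef
  have hD : IsOpen D := isOpen_cartesian hΩ₁ isOpen_univ
  set Ω : Set (Total n₁ n) := cartesian Ω₁ Ω₂ with hΩdef
  have hΩb : Bornology.IsBounded Ω := isBounded_cartesian hb₁ hb₂
  have hΩD : Ω ⊆ D := fun x hx => ⟨hx.1, mem_univ _⟩
  set F : Set (Total n₁ n) := cartesian (frontier Ω₁) Ω₂ with hFdef
  have hFm : MeasurableSet F :=
    measurableSet_cartesian isClosed_frontier.measurableSet hΩ₂.measurableSet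
  have hFfin : (Measure.euclideanHausdorffMeasure (Module.finrank ℝ (Total n₁ n) - 1) :
      Measure (Total n₁ n)) F ≠ ⊤ :=
    ((measure_mono (lateral_subset_frontier _ _)).trans_lt
      (hLip.hausdorffMeasure_frontier_lt_top hΩb)).ne
  have hcone : ∀ x ∈ D ∩ Metric.ball a r, ∀ t ∈ Ioo 0 r, ∀ z ∈ Metric.ball (t • ν) (c * t),
      x + z ∈ D := fun x hx t ht z hz =>
    hΩD (hcone₀ x ⟨⟨hx.1.1, hballr x hx.2⟩, Metric.ball_subset_ball (min_le_left _ _) hx.2⟩ t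
      ⟨ht.1, ht.2.trans_le (min_le_left _ _)⟩ z hz)
  -- With `t < r / 8`, the support of `φ` lies in the ball of radius `r - 2 t` where `w` vanishes
  -- off `D`, and frontier points within `3 t` of it are still in the ball of radius `r`, hence over
  -- `Ω₂`.
  refine ⟨r / 4, by positivity, fun φ hφ hφc hφs δ hδ => ?_⟩
  obtain ⟨K, hK⟩ := (hφ.of_le (by exact_mod_cast le_top)).lipschitzWith_of_hasCompactSupport hφc
    one_ne_zero
  obtain ⟨M₁, hM₁⟩ := hφc.exists_bound_of_continuous hφ.continuous
  obtain ⟨M₂, hM₂⟩ := (hasCompactSupport_gradient hφc).exists_bound_of_continuous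
    (continuous_gradient hφ)
  set M : ℝ := max M₁ M₂ with hM
  have hM0 : 0 ≤ M := (norm_nonneg _).trans ((hM₁ 0).trans (le_max_left _ _))
  set V : ℝ → ℝ≥0∞ := fun t => volume.restrict Ω (Metric.cthickening (2 * t) Dᶜ) with hV
  have hVt : Tendsto V (𝓝[>] 0) (𝓝 0) := tendsto_volume_inter_cthickening_compl hD hΩD hΩb
  set μF := (Measure.euclideanHausdorffMeasure (Module.finrank ℝ (Total n₁ n) - 1) :
      Measure (Total n₁ n)) F with hμF
  have hT1 : Tendsto (fun t => ENNReal.ofReal M * V t) (𝓝[>] 0) (𝓝 0) := by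
    simpa using ENNReal.Tendsto.const_mul hVt (Or.inr ENNReal.ofReal_ne_top)
  have hT2 : Tendsto (fun t : ℝ => ENNReal.ofReal (K * (2 * t)) * μF) (𝓝[>] 0) (𝓝 0) := by
    have h1 : Tendsto (fun t : ℝ => ENNReal.ofReal (K * (2 * t))) (𝓝[>] 0) (𝓝 0) := by
      have : Continuous fun t : ℝ => ENNReal.ofReal (K * (2 * t)) :=
        ENNReal.continuous_ofReal.comp (by fun_prop)
      simpa using (this.tendsto 0).mono_left nhdsWithin_le_nhds
    simpa using ENNReal.Tendsto.mul_const h1 (Or.inr hFfin)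
  have hT3 : Tendsto (fun t => ENNReal.ofReal M * V t + ENNReal.ofReal (K * (2 * t)) * μF)
      (𝓝[>] 0) (𝓝 0) := by simpa using hT1.add hT2
  have hT4 : ∀ i, Tendsto (fun t => ENNReal.ofReal M * V t ^ (1 / p i)) (𝓝[>] 0) (𝓝 0) := by
    intro i
    have h0 : 0 < 1 / p i := by have := hp i; positivity
    have h1 := ((ENNReal.continuous_rpow_const (y := 1 / p i)).tendsto 0).comp hVt
    rw [ENNReal.zero_rpow_of_pos h0] at h1
    simpa using ENNReal.Tendsto.const_mul h1 (Or.inr ENNReal.ofReal_ne_top)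
  have hδ' : 0 < δ := pos_iff_ne_zero.2 hδ
  obtain ⟨t, ht3, ht4, ht0, ht1⟩ := ((hT3.eventually (gt_mem_nhds hδ')).and
    ((eventually_all.2 fun i => (hT4 i).eventually (gt_mem_nhds hδ')).and
      (Ioo_mem_nhdsGT (show 0 < min (ε / 2) (r / 8) by positivity)))).exists
  have htε : 2 * t ≤ ε := by linarith [ht1.trans_le (min_le_left _ _)]
  have htr : t < r / 8 := ht1.trans_le (min_le_right _ _)
  obtain ⟨w, hw, hw0, hw1, hwb, hwi, hwinv, hwg⟩ :=
    exists_barrier hD hν hc hc1 hcone ⟨ht0, by linarith⟩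
  have hwsnd : ∀ x, (gradient w x).snd = 0 :=
    snd_gradient_eq_zero_of_invariant (hw.differentiable (by simp)) fun y =>
      hwinv _ fun x => by simp [D, cartesian]
  set S : Set (Total n₁ n) := Metric.cthickening (2 * t) Dᶜ with hS
  have hSm : MeasurableSet S := Metric.isClosed_cthickening.measurableSet
  have hwS : ∀ x, x ∉ S → w x = 1 := by
    intro x hx
    refine hwi x fun y hy => ?_
    by_contra hyD
    exact hx (Metric.mem_cthickening_of_dist_le x y _ _ hyD (Metric.mem_ball'.1 hy).le)
  have hgrad : ∀ x, gradient (fun y => φ y * (1 - w y)) x =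
      (1 - w x) • gradient φ x - φ x • gradient w x := fun x =>
    gradient_mul_one_sub (hφ.differentiable (by simp) x) (hw.differentiable (by simp) x)
  have hgsnd : ∀ x, (gradient (fun y => φ y * (1 - w y)) x).snd =
      (1 - w x) • (gradient φ x).snd := fun x => by
    rw [hgrad, WithLp.sub_snd, WithLp.smul_snd, WithLp.smul_snd, hwsnd, smul_zero, sub_zero]
  have hwn : ∀ x, ‖1 - w x‖ₑ ≤ S.indicator (fun _ => (1 : ℝ≥0∞)) x := by
    intro x
    by_cases hx : x ∈ S
    · rw [indicator_of_mem hx, ← ofReal_norm, Real.norm_of_nonneg (by linarith [hw1 x])]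
      exact ENNReal.ofReal_le_one.2 (by linarith [hw0 x])
    · simp [hx, hwS x hx]
  have hφM : ∀ x, ‖φ x‖ₑ ≤ ENNReal.ofReal M := fun x => by
    rw [← ofReal_norm]; exact ENNReal.ofReal_le_ofReal ((hM₁ x).trans (le_max_left _ _))
  have hgM : ∀ x, ‖gradient φ x‖ₑ ≤ ENNReal.ofReal M := fun x => by
    rw [← ofReal_norm]; exact ENNReal.ofReal_le_ofReal ((hM₂ x).trans (le_max_right _ _))
  have hint : ∫⁻ x in Ω, ENNReal.ofReal M * S.indicator (fun _ => (1 : ℝ≥0∞)) x =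
      ENNReal.ofReal M * V t := by
    rw [lintegral_const_mul _ (measurable_const.indicator hSm), lintegral_indicator_const hSm,
      one_mul]
  have htle : ENNReal.ofReal M * V t ≤ δ := le_self_add.trans ht3.le
  have hsuppsub : tsupport (fun y => φ y * (1 - w y)) ⊆ tsupport φ :=
    closure_mono fun x hx hφx => hx (by simp [hφx])
  have hφball : ∀ x, φ x ≠ 0 → dist x a < r / 4 := fun x hx =>
    Metric.mem_ball.1 (hφs (subset_tsupport φ hx))
  refine ⟨fun y => φ y * (1 - w y), hφ.mul (contDiff_const.sub hw), hφc.mul_right,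
    fun x hx => hballr x ?_, fun x hx => ?_, fun x hx hne => ?_, ?_, ?_, ?_, fun i => ?_⟩
  · exact Metric.ball_subset_ball (by linarith) (hφs (hsuppsub hx))
  · by_cases h0 : φ x = 0
    · simp [h0]
    · have hxD : x ∉ D := fun h =>
        (hΩ₁.frontier_eq ▸ hx.1 : x.fst ∈ closure Ω₁ \ Ω₁).2 h.1
      rw [hwb x (Metric.mem_ball.2 (by linarith [hφball x h0])) hxD, sub_zero, mul_one]
  · refine mem_cthickening_lateral_of_not_ball_subset htε hx.2 hx.1 fun h => hne ?_
    rw [hwi x h, sub_self, mul_zero]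
  · refine le_trans (lintegral_mono fun x => ?_) (hint.le.trans htle)
    rw [enorm_mul]
    exact mul_le_mul' (hφM x) (hwn x)
  · have h1 : ∀ x, ‖(gradient (fun y => φ y * (1 - w y)) x).fst‖ₑ ≤
        ENNReal.ofReal M * S.indicator (fun _ => (1 : ℝ≥0∞)) x + ‖φ x‖ₑ * ‖gradient w x‖ₑ := by
      intro x
      refine (WithLp.enorm_fst_le _ _).trans ?_
      rw [hgrad]
      refine (enorm_sub_le).trans ?_
      rw [enorm_smul, enorm_smul, mul_comm (ENNReal.ofReal M)]
      gcongr
      · exact hwn x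
      · exact hgM x
    have h2 : ∫⁻ x in Ω, ‖φ x‖ₑ * ‖gradient w x‖ₑ ≤
        ∫⁻ x, ‖φ x‖ₑ ∂(surfaceMeasure F) + ENNReal.ofReal (K * (2 * t)) * μF := by
      refine (setLIntegral_le_lintegral _ _).trans ((hwg φ K F hφ.continuous hK hFm hFfin ?_).trans
        (le_of_eq ?_))
      · intro x hx q hq hxq
        rw [frontier_cartesian_univ] at hq
        refine ⟨hq.1, hballr q (Metric.mem_ball.2 ?_)⟩
        linarith [hφball x hx, dist_triangle_left q a x]
      · rw [lintegral_add_right _ measurable_const, lintegral_const, Measure.restrict_apply_univ]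
        rfl
    refine (lintegral_mono h1).trans ?_
    have h3 : Measurable fun x => ENNReal.ofReal M * S.indicator (fun _ => (1 : ℝ≥0∞)) x :=
      measurable_const.mul (measurable_const.indicator hSm)
    rw [lintegral_add_left h3, hint]
    calc _ ≤ ENNReal.ofReal M * V t +
          (∫⁻ x, ‖φ x‖ₑ ∂(surfaceMeasure F) + ENNReal.ofReal (K * (2 * t)) * μF) := by gcongr
      _ = ∫⁻ x, ‖φ x‖ₑ ∂(surfaceMeasure F) +
          (ENNReal.ofReal M * V t + ENNReal.ofReal (K * (2 * t)) * μF) := by ring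
      _ ≤ _ := by gcongr
  · refine le_trans (lintegral_mono fun x => ?_) (hint.le.trans htle)
    rw [hgsnd, enorm_smul, mul_comm (ENNReal.ofReal M)]
    exact mul_le_mul' (hwn x) ((WithLp.enorm_snd_le _ _).trans (hgM x))
  · have h1 : eLpNorm (fun x => (gradient (fun y => φ y * (1 - w y)) x).snd i)
        (ENNReal.ofReal (p i)) (volume.restrict Ω) ≤
        eLpNorm (S.indicator fun _ => M) (ENNReal.ofReal (p i)) (volume.restrict Ω) := by
      refine eLpNorm_mono_enorm fun x => ?_
      rw [hgsnd, PiLp.smul_apply, enorm_smul, enorm_indicator_eq_indicator_enorm]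
      have h2 : ‖(gradient φ x).snd i‖ₑ ≤ ENNReal.ofReal M :=
        (PiLp.enorm_apply_le _ i).trans ((WithLp.enorm_snd_le _ _).trans (hgM x))
      refine (mul_le_mul' (hwn x) h2).trans ?_
      by_cases hx : x ∈ S
      · simp [hx, ← ofReal_norm, abs_of_nonneg hM0]
      · simp [hx]
    refine h1.trans ((eLpNorm_indicator_const_le _ _).trans ?_)
    rw [ENNReal.toReal_ofReal (by linarith [hp i]), ← ofReal_norm, Real.norm_of_nonneg hM0]
    exact (ht4 i).le

end LocalExtension

/-! ### Gluing, and integrable boundary data -/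

section Approximation

variable {n₁ m : ℕ} {n : Fin m → ℕ} {Ω₁ : Set (EuclideanSpace ℝ (Fin n₁))} {Ω₂ : Set (Rest n)}
  {p : Fin m → ℝ} {ε : ℝ}

lemma IsThinExtension.mono {φ φ' u : Total n₁ n → ℝ} {A A' δ δ' : ℝ≥0∞}
    (h : IsThinExtension Ω₁ Ω₂ p ε φ u A δ) (hA : A ≤ A') (hδ : δ ≤ δ')
    (hφ : ∀ x ∈ cartesian (frontier Ω₁) Ω₂, φ x = φ' x) :
    IsThinExtension Ω₁ Ω₂ p ε φ' u A' δ' where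
  contDiff := h.contDiff
  hasCompactSupport := h.hasCompactSupport
  tsupport_subset := h.tsupport_subset
  eq_lateral x hx := (h.eq_lateral x hx).trans (hφ x hx)
  mem_cthickening := h.mem_cthickening
  lintegral_le := h.lintegral_le.trans hδ
  lintegral_fst_le := h.lintegral_fst_le.trans hA
  lintegral_snd_le := h.lintegral_snd_le.trans hδ
  eLpNorm_snd_le i := (h.eLpNorm_snd_le i).trans hδ

/-- Finitely many good balls cover the compact part of the support of `φ` over `∂Ω₁`. A subordinate
partition is nonnegative with sum at most 1, so the main terms of the pieces add up to at most `∫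
|φ|`; it has sum 1 wherever `φ` must be reproduced. -/
lemma exists_thin_extension (hΩ₁ : IsOpen Ω₁) (hΩ₂ : IsOpen Ω₂)
    (hb₁ : Bornology.IsBounded Ω₁) (hb₂ : Bornology.IsBounded Ω₂)
    (hLip : HasLipschitzBoundary (cartesian Ω₁ Ω₂)) (hp : ∀ i, 1 < p i) (hε : 0 < ε)
    {φ : Total n₁ n → ℝ} (hφ : ContDiff ℝ ∞ φ) (hφc : HasCompactSupport φ)
    (hφs : tsupport φ ⊆ {x | x.snd ∈ Ω₂}) {δ : ℝ≥0∞} (hδ : δ ≠ 0) :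
    ∃ u, IsThinExtension Ω₁ Ω₂ p ε φ u
      (∫⁻ x, ‖φ x‖ₑ ∂(surfaceMeasure (cartesian (frontier Ω₁) Ω₂)) + δ) δ := by
  have hfst := WithLp.continuous_fst 2 (EuclideanSpace ℝ (Fin n₁)) (Rest n)
  set C : Set (Total n₁ n) := tsupport φ ∩ WithLp.fst ⁻¹' frontier Ω₁ with hC
  have hCc : IsCompact C :=
    IsCompact.inter_right hφc (isClosed_frontier.preimage hfst)
  have hCF : C ⊆ cartesian (frontier Ω₁) Ω₂ := fun x hx => ⟨hx.2, hφs hx.1⟩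
  choose! R hR hRu using fun (a : Total n₁ n) (ha : a ∈ cartesian (frontier Ω₁) Ω₂) =>
    exists_thin_extension_near hΩ₁ hΩ₂ hb₁ hb₂ hLip hp hε ha
  obtain ⟨s, hsC, hsu⟩ := hCc.elim_nhds_subcover (fun a => Metric.ball a (R a))
    fun a ha => Metric.ball_mem_nhds a (hR a (hCF ha))
  obtain ⟨f, hf⟩ := SmoothPartitionOfUnity.exists_isSubordinate
    (modelWithCornersSelf ℝ (Total n₁ n)) hCc.isClosed
    (fun i : s => Metric.ball (i : Total n₁ n) (R i)) (fun i => Metric.isOpen_ball)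
    (fun x hx => by
      obtain ⟨i, hi, hxi⟩ := mem_iUnion₂.1 (hsu hx)
      exact mem_iUnion.2 ⟨⟨i, hi⟩, hxi⟩)
  -- The added 1 keeps the divisor nonzero when no ball is needed.
  set δ' : ℝ≥0∞ := δ / (Fintype.card s + 1) with hδ'
  have hcard : (Fintype.card s + 1 : ℝ≥0∞) ≠ ⊤ := by finiteness
  have hδ'0 : δ' ≠ 0 := ENNReal.div_ne_zero.2 ⟨hδ, hcard⟩
  have hpiece : ∀ i : s, ∃ u, IsThinExtension Ω₁ Ω₂ p ε (fun x => f i x * φ x) u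
      (∫⁻ x, ‖f i x * φ x‖ₑ ∂(surfaceMeasure (cartesian (frontier Ω₁) Ω₂)) + δ') δ' := by
    intro i
    refine hRu i (hCF (hsC i i.2)) _ ((f i).contMDiff.contDiff.mul hφ) hφc.mul_left ?_ δ' hδ'0
    exact (closure_mono fun x hx => left_ne_zero_of_mul hx).trans (hf i)
  choose u hu using hpiece
  have hsum : ∑ _i : s, δ' ≤ δ := by
    rw [Finset.sum_const, Finset.card_univ, nsmul_eq_mul]
    calc (Fintype.card s : ℝ≥0∞) * δ' ≤ (Fintype.card s + 1) * δ' := by gcongr; exact le_self_add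
      _ = δ := ENNReal.mul_div_cancel (by simp) hcard
  have hmeas : ∀ i : s, Measurable fun x => ‖f i x * φ x‖ₑ := fun i =>
    ((f i).contMDiff.contDiff.continuous.mul hφ.continuous).enorm.measurable
  refine ⟨_, (IsThinExtension.sum hp Finset.univ fun i _ => hu i).mono ?_ hsum ?_⟩
  · rw [Finset.sum_add_distrib, ← lintegral_finsetSum _ fun i _ => hmeas i]
    gcongr with x
    calc ∑ i, ‖f i x * φ x‖ₑ = (∑ i, ‖f i x‖ₑ) * ‖φ x‖ₑ := by
          rw [Finset.sum_mul]
          exact Finset.sum_congr rfl fun i _ => enorm_mul _ _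
      _ = ENNReal.ofReal (∑ i, f i x) * ‖φ x‖ₑ := by
          rw [ENNReal.ofReal_sum_of_nonneg fun i _ => f.nonneg i x]
          congr 1
          refine Finset.sum_congr rfl fun i _ => ?_
          rw [← ofReal_norm, Real.norm_of_nonneg (f.nonneg i x)]
      _ ≤ 1 * ‖φ x‖ₑ := by
          gcongr
          rw [← finsum_eq_sum_of_fintype]
          exact ENNReal.ofReal_le_one.2 (f.sum_le_one x)
      _ = ‖φ x‖ₑ := one_mul _
  · intro x hx
    rw [← Finset.sum_mul]
    by_cases h0 : φ x = 0
    · simp [h0]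
    · have h1 := f.sum_eq_one (x := x) ⟨subset_tsupport φ h0, hx.1⟩
      rw [finsum_eq_sum_of_fintype] at h1
      rw [h1, one_mul]

/-- A smooth `L¹` approximation `g` is multiplied by a cutoff equal to 1 on a compact `C ⊆ U`, where
`μ (U \ C)` is small compared with the bound for `g`. -/
lemma exists_contDiff_tsupport_subset_lintegral_sub_le {E : Type*} [NormedAddCommGroup E]
    [InnerProductSpace ℝ E] [FiniteDimensional ℝ E] [MeasurableSpace E] [BorelSpace E]
    {μ : Measure E} [IsFiniteMeasure μ] {U : Set E} (hU : IsOpen U) (hμU : μ Uᶜ = 0) {f : E → ℝ}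
    (hf : Integrable f μ) {η : ℝ≥0∞} (hη : η ≠ 0) :
    ∃ g : E → ℝ, ContDiff ℝ ∞ g ∧ HasCompactSupport g ∧ tsupport g ⊆ U ∧
      ∫⁻ x, ‖f x - g x‖ₑ ∂μ ≤ η := by
  obtain ⟨e, he0, heη⟩ : ∃ e : ℝ, 0 < e ∧ ENNReal.ofReal e ≤ η / 2 := by
    obtain ⟨e, he0, he⟩ := ENNReal.lt_iff_exists_nnreal_btwn.1 (ENNReal.half_pos hη)
    exact ⟨e, by exact_mod_cast he0, by rw [ENNReal.ofReal_coe_nnreal]; exact he.le⟩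
  obtain ⟨g, hgc, hg, hfg⟩ :=
    (memLp_one_iff_integrable.2 hf).exist_eLpNorm_sub_le ENNReal.one_ne_top le_rfl he0
  obtain ⟨M, hM⟩ := hgc.exists_bound_of_continuous hg.continuous
  have hM0 : 0 ≤ M := (norm_nonneg _).trans (hM 0)
  obtain ⟨C, hCU, hCc, hC⟩ := hU.measurableSet.exists_isCompact_sdiff_lt (measure_ne_top μ U)
    (ε := ENNReal.ofReal (e / (M + 1))) (by simpa using by positivity)
  obtain ⟨L, hLc, hCL, hLU⟩ := exists_compact_between hCc hU hCU
  obtain ⟨κ, hκ0, hκ1, hκ⟩ := exists_contMDiffMap_zero_one_of_isClosed (n := (⊤ : ℕ∞))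
    (modelWithCornersSelf ℝ E) (isClosed_compl_iff.2 (isOpen_interior (s := L))) hCc.isClosed
    (disjoint_left.2 fun x hx hxC => hx (hCL hxC))
  have hκs : tsupport (fun x => κ x * g x) ⊆ L := by
    refine closure_minimal (fun x hx => ?_) hLc.isClosed
    by_contra hxL
    refine hx ?_
    simp only
    rw [hκ0 fun h => hxL (interior_subset h)]
    simp
  refine ⟨fun x => κ x * g x, κ.contMDiff.contDiff.mul hg, hgc.mul_left, hκs.trans hLU, ?_⟩
  have hfg' : ∫⁻ x, ‖f x - g x‖ₑ ∂μ ≤ ENNReal.ofReal e := by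
    rw [eLpNorm_one_eq_lintegral_enorm] at hfg
    exact hfg
  have h1 : ∀ᵐ x ∂μ, ‖g x - κ x * g x‖ₑ ≤ (U \ C).indicator (fun _ => ENNReal.ofReal M) x := by
    have : ∀ᵐ x ∂μ, x ∈ U := by rw [ae_iff]; exact hμU
    filter_upwards [this] with x hx
    by_cases hxC : x ∈ C
    · simp [hκ1 hxC]
    · rw [indicator_of_mem (show x ∈ U \ C from ⟨hx, hxC⟩), ← ofReal_norm]
      refine ENNReal.ofReal_le_ofReal ?_
      rw [← one_sub_mul, norm_mul, Real.norm_of_nonneg (by linarith [(hκ x).2])]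
      have := hM x
      nlinarith [(hκ x).1, norm_nonneg (g x)]
  have h2 : ∫⁻ x, ‖g x - κ x * g x‖ₑ ∂μ ≤ ENNReal.ofReal e := by
    refine (lintegral_mono_ae h1).trans ?_
    rw [lintegral_indicator_const (hU.measurableSet.diff hCc.measurableSet)]
    refine (mul_le_mul' le_rfl hC.le).trans ?_
    rw [← ENNReal.ofReal_mul hM0]
    refine ENNReal.ofReal_le_ofReal ?_
    rw [mul_div_assoc', div_le_iff₀ (by positivity)]
    nlinarith
  have h3 : ∀ x, ‖f x - κ x * g x‖ₑ ≤ ‖f x - g x‖ₑ + ‖g x - κ x * g x‖ₑ := fun x => by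
    rw [show f x - κ x * g x = (f x - g x) + (g x - κ x * g x) by ring]
    exact enorm_add_le _ _
  refine (lintegral_mono h3).trans ?_
  have hm : Measurable fun x => ‖g x - κ x * g x‖ₑ := by
    have := κ.contMDiff.contDiff.continuous
    have := hg.continuous
    exact Continuous.measurable (by fun_prop)
  rw [lintegral_add_right _ hm]
  calc _ ≤ η / 2 + η / 2 := add_le_add (hfg'.trans heη) (h2.trans heη)
    _ = η := ENNReal.add_halves η

lemma isFiniteMeasure_surfaceMeasure_lateral (hb₁ : Bornology.IsBounded Ω₁)
    (hb₂ : Bornology.IsBounded Ω₂) (hLip : HasLipschitzBoundary (cartesian Ω₁ Ω₂)) :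
    IsFiniteMeasure (surfaceMeasure (cartesian (frontier Ω₁) Ω₂)) := by
  refine ⟨?_⟩
  rw [surfaceMeasure, Measure.restrict_apply_univ]
  exact (measure_mono (lateral_subset_frontier _ _)).trans_lt
    (hLip.hausdorffMeasure_frontier_lt_top (isBounded_cartesian hb₁ hb₂))

/-- With smooth `H k` at `L¹` distance at most `d k` from `f`, the telescoping terms have norms at
most `‖f‖ + d 0` and `d j + d (j + 1)`, and extending the `k`-th one costs `d k` more. The total
excess is three times `∑ d k`, whence the choice `∑ d k < η / 4`. -/
lemma exists_thin_extension_series (hΩ₁ : IsOpen Ω₁) (hΩ₂ : IsOpen Ω₂)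
    (hb₁ : Bornology.IsBounded Ω₁) (hb₂ : Bornology.IsBounded Ω₂)
    (hLip : HasLipschitzBoundary (cartesian Ω₁ Ω₂)) (hp : ∀ i, 1 < p i) (hε : 0 < ε)
    {f : Total n₁ n → ℝ} (hf : Integrable f (surfaceMeasure (cartesian (frontier Ω₁) Ω₂)))
    {η : ℝ≥0∞} (hη : η ≠ 0) :
    ∃ (φ u : ℕ → Total n₁ n → ℝ) (A δ : ℕ → ℝ≥0∞),
      (∀ k, IsThinExtension Ω₁ Ω₂ p ε (φ k) (u k) (A k) (δ k)) ∧
      ∑' k, A k ≤ ∫⁻ x, ‖f x‖ₑ ∂(surfaceMeasure (cartesian (frontier Ω₁) Ω₂)) + η ∧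
      ∑' k, δ k ≤ η ∧
      Tendsto (fun N => ∫⁻ x, ‖∑ k ∈ Finset.range N, φ k x - f x‖ₑ
        ∂(surfaceMeasure (cartesian (frontier Ω₁) Ω₂))) atTop (𝓝 0) := by
  have := isFiniteMeasure_surfaceMeasure_lateral hb₁ hb₂ hLip
  set μ := surfaceMeasure (cartesian (frontier Ω₁) Ω₂) with hμ
  have hFm : MeasurableSet (cartesian (frontier Ω₁) Ω₂) :=
    measurableSet_cartesian isClosed_frontier.measurableSet hΩ₂.measurableSet
  have hU : IsOpen {x : Total n₁ n | x.snd ∈ Ω₂} :=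
    hΩ₂.preimage (WithLp.continuous_snd 2 (EuclideanSpace ℝ (Fin n₁)) (Rest n))
  have hμU : μ {x : Total n₁ n | x.snd ∈ Ω₂}ᶜ = 0 := by
    rw [hμ, surfaceMeasure, Measure.restrict_apply hU.measurableSet.compl,
      show {x : Total n₁ n | x.snd ∈ Ω₂}ᶜ ∩ cartesian (frontier Ω₁) Ω₂ = ∅ from
        eq_empty_of_forall_notMem fun x hx => hx.1 hx.2.2]
    exact measure_empty
  obtain ⟨d, hd0, hd⟩ := ENNReal.exists_pos_sum_of_countable'
    (ε := η / 4) (ENNReal.div_ne_zero.2 ⟨hη, by simp⟩) ℕ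
  have hd4 : (∑' k, d k) + (∑' k, d k) + (∑' k, d k) + (∑' k, d k) ≤ η := by
    calc _ ≤ η / 4 + η / 4 + η / 4 + η / 4 := by gcongr
      _ = 4 * (η / 4) := by ring
      _ = η := ENNReal.mul_div_cancel (by simp) (by simp)
  choose H hH hHc hHs hHf using fun k =>
    exists_contDiff_tsupport_subset_lintegral_sub_le hU hμU hf (hd0 k).ne'
  let φ : ℕ → Total n₁ n → ℝ := fun k x => Nat.casesOn k (H 0 x) fun j => H (j + 1) x - H j x
  have hφ : ∀ k, ContDiff ℝ ∞ (φ k) ∧ HasCompactSupport (φ k) ∧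
      tsupport (φ k) ⊆ {x | x.snd ∈ Ω₂} := by
    intro k
    cases k with
    | zero => exact ⟨hH 0, hHc 0, hHs 0⟩
    | succ j =>
      refine ⟨(hH (j + 1)).sub (hH j), (hHc (j + 1)).sub (hHc j), ?_⟩
      exact (tsupport_sub (H (j + 1)) (H j)).trans (union_subset (hHs (j + 1)) (hHs j))
  have hsum : ∀ N x, ∑ k ∈ Finset.range (N + 1), φ k x = H N x := by
    intro N x
    induction N with
    | zero => simp [φ]
    | succ N ih => rw [Finset.sum_range_succ, ih]; simp [φ]
  have hm : ∀ k, AEMeasurable (fun x => ‖f x - H k x‖ₑ) μ := fun k =>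
    (hf.aestronglyMeasurable.sub (hH k).continuous.aestronglyMeasurable).enorm
  have hφ0 : ∫⁻ x, ‖φ 0 x‖ₑ ∂μ ≤ ∫⁻ x, ‖f x‖ₑ ∂μ + d 0 := by
    calc ∫⁻ x, ‖φ 0 x‖ₑ ∂μ ≤ ∫⁻ x, (‖f x‖ₑ + ‖f x - H 0 x‖ₑ) ∂μ := by
          refine lintegral_mono fun x => ?_
          rw [show φ 0 x = f x - (f x - H 0 x) by simp [φ]]
          exact enorm_sub_le
      _ = ∫⁻ x, ‖f x‖ₑ ∂μ + ∫⁻ x, ‖f x - H 0 x‖ₑ ∂μ := lintegral_add_right' _ (hm 0)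
      _ ≤ _ := by gcongr; exact hHf 0
  have hφs : ∀ j, ∫⁻ x, ‖φ (j + 1) x‖ₑ ∂μ ≤ d j + d (j + 1) := by
    intro j
    calc ∫⁻ x, ‖φ (j + 1) x‖ₑ ∂μ ≤ ∫⁻ x, (‖f x - H j x‖ₑ + ‖f x - H (j + 1) x‖ₑ) ∂μ := by
          refine lintegral_mono fun x => ?_
          rw [show φ (j + 1) x = (f x - H j x) - (f x - H (j + 1) x) by simp [φ]]
          exact enorm_sub_le
      _ = _ := lintegral_add_right' _ (hm (j + 1))
      _ ≤ _ := add_le_add (hHf j) (hHf (j + 1))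
  choose u hu using fun k => exists_thin_extension hΩ₁ hΩ₂ hb₁ hb₂ hLip hp hε (hφ k).1 (hφ k).2.1
    (hφ k).2.2 (hd0 k).ne'
  refine ⟨φ, u, _, d, hu, ?_, ?_, ?_⟩
  · rw [ENNReal.tsum_add, tsum_eq_zero_add' ENNReal.summable]
    have h1 : ∑' j, ∫⁻ x, ‖φ (j + 1) x‖ₑ ∂μ ≤ ∑' k, d k + ∑' j, d (j + 1) := by
      rw [← ENNReal.tsum_add]
      exact ENNReal.tsum_le_tsum hφs
    have h2 : d 0 + ∑' j, d (j + 1) = ∑' k, d k := (tsum_eq_zero_add' ENNReal.summable).symm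
    calc _ ≤ (∫⁻ x, ‖f x‖ₑ ∂μ + d 0) + (∑' k, d k + ∑' j, d (j + 1)) + ∑' k, d k := by
          gcongr
      _ = ∫⁻ x, ‖f x‖ₑ ∂μ + (∑' k, d k + (d 0 + ∑' j, d (j + 1)) + ∑' k, d k) := by ring
      _ ≤ ∫⁻ x, ‖f x‖ₑ ∂μ + η := by
          rw [h2]
          gcongr
          exact le_self_add.trans hd4
  · exact (le_self_add.trans le_self_add).trans (le_self_add.trans hd4)
  · rw [← tendsto_add_atTop_iff_nat 1]
    have hdt : Tendsto d atTop (𝓝 0) :=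
      ENNReal.tendsto_atTop_zero_of_tsum_ne_top (hd.trans_le le_top).ne
    refine tendsto_of_tendsto_of_tendsto_of_le_of_le tendsto_const_nhds hdt (fun _ => zero_le)
      fun N => ?_
    refine le_trans (le_of_eq ?_) (hHf N)
    refine lintegral_congr fun x => ?_
    rw [hsum, enorm_sub_rev]

end Approximation

/-! ### Absolutely convergent series of integrable functions -/

section Series

variable {α : Type*} [MeasurableSpace α] {μ : Measure α} {B : Type*} [NormedAddCommGroup B]

lemma ae_summable_of_tsum_lintegral_ne_top [CompleteSpace B] {v : ℕ → α → B} (hv : ∀ k, AEStronglyMeasurable (v k) μ)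
    (h : ∑' k, ∫⁻ x, ‖v k x‖ₑ ∂μ ≠ ⊤) : ∀ᵐ x ∂μ, Summable fun k => v k x := by
  rw [← lintegral_tsum fun k => (hv k).enorm] at h
  filter_upwards [ae_lt_top' (AEMeasurable.tsum fun k => (hv k).enorm) h] with x hx
  refine Summable.of_norm ?_
  have := ENNReal.summable_toReal hx.ne
  simpa using this

lemma aestronglyMeasurable_tsum {v : ℕ → α → B} (hv : ∀ k, AEStronglyMeasurable (v k) μ)
    (hs : ∀ᵐ x ∂μ, Summable fun k => v k x) :
    AEStronglyMeasurable (fun x => ∑' k, v k x) μ := by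
  refine aestronglyMeasurable_of_tendsto_ae atTop
    (f := fun N x => ∑ k ∈ Finset.range N, v k x)
    (fun N => Finset.aestronglyMeasurable_fun_sum _ fun k _ => hv k) ?_
  filter_upwards [hs] with x hx using hx.hasSum.tendsto_sum_nat

lemma enorm_tsum_le {v : ℕ → B} : ‖∑' k, v k‖ₑ ≤ ∑' k, ‖v k‖ₑ := by
  by_cases h : Summable v
  · refine le_of_tendsto (h.hasSum.tendsto_sum_nat.enorm) (Eventually.of_forall fun N => ?_)
    exact (enorm_sum_le _ _).trans (ENNReal.sum_le_tsum _)
  · rw [tsum_eq_zero_of_not_summable h]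
    simp

lemma integrable_tsum [CompleteSpace B] {v : ℕ → α → B} (hv : ∀ k, AEStronglyMeasurable (v k) μ)
    (h : ∑' k, ∫⁻ x, ‖v k x‖ₑ ∂μ ≠ ⊤) : Integrable (fun x => ∑' k, v k x) μ := by
  refine ⟨aestronglyMeasurable_tsum hv (ae_summable_of_tsum_lintegral_ne_top hv h), ?_⟩
  refine lt_of_le_of_lt (lintegral_mono fun x => enorm_tsum_le) ?_
  rw [lintegral_tsum fun k => (hv k).enorm]
  exact h.lt_top

lemma tendsto_eLpNorm_sum_sub_tsum [CompleteSpace B] {v : ℕ → α → B} (hv : ∀ k, AEStronglyMeasurable (v k) μ)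
    (h : ∑' k, ∫⁻ x, ‖v k x‖ₑ ∂μ ≠ ⊤) :
    Tendsto (fun N => eLpNorm (fun x => ∑ k ∈ Finset.range N, v k x - ∑' k, v k x) 1 μ)
      atTop (𝓝 0) := by
  have ht := ENNReal.tendsto_sum_nat_add (fun k => ∫⁻ x, ‖v k x‖ₑ ∂μ) h
  refine tendsto_of_tendsto_of_tendsto_of_le_of_le tendsto_const_nhds ht (fun _ => zero_le)
    fun N => ?_
  rw [eLpNorm_one_eq_lintegral_enorm, ← lintegral_tsum fun k => (hv (k + N)).enorm]
  refine lintegral_mono_ae ?_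
  filter_upwards [ae_summable_of_tsum_lintegral_ne_top hv h] with x hx
  rw [← hx.sum_add_tsum_nat_add N, sub_add_cancel_left, enorm_neg]
  exact enorm_tsum_le

/-- Fatou's lemma along the partial sums; almost everywhere convergence suffices, so the exponent is
arbitrary. -/
lemma eLpNorm_tsum_le_of_sum_le {v : ℕ → α → B} (hv : ∀ k, AEStronglyMeasurable (v k) μ)
    (hs : ∀ᵐ x ∂μ, Summable fun k => v k x) {p C : ℝ≥0∞}
    (hC : ∀ N, eLpNorm (fun x => ∑ k ∈ Finset.range N, v k x) p μ ≤ C) :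
    eLpNorm (fun x => ∑' k, v k x) p μ ≤ C := by
  refine (Lp.eLpNorm_lim_le_liminf_eLpNorm
    (f := fun N x => ∑ k ∈ Finset.range N, v k x)
    (fun N => Finset.aestronglyMeasurable_fun_sum _ fun k _ => hv k) _ ?_).trans ?_
  · filter_upwards [hs] with x hx using hx.hasSum.tendsto_sum_nat
  · exact liminf_le_of_le (by isBoundedDefault) fun b hb => by
      obtain ⟨N, hN⟩ := hb.exists
      exact hN.trans (hC N)

end Series

/-! ### Finite sums of smooth functions -/

section FiniteSums

variable {E : Type*} [NormedAddCommGroup E]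

lemma gradient_sum_eq [InnerProductSpace ℝ E] [CompleteSpace E] {ι : Type*} {u : ι → E → ℝ} (hu : ∀ k, ContDiff ℝ ∞ (u k)) (s : Finset ι)
    (x : E) : gradient (fun y => ∑ k ∈ s, u k y) x = ∑ k ∈ s, gradient (u k) x := by
  simp only [gradient]
  rw [fderiv_fun_sum fun k _ => (hu k).differentiable (by simp) x, map_sum]

lemma hasCompactSupport_sum {ι : Type*} {u : ι → E → ℝ} (hc : ∀ k, HasCompactSupport (u k))
    (s : Finset ι) : HasCompactSupport fun y => ∑ k ∈ s, u k y := by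
  classical
  induction s using Finset.induction_on with
  | empty =>
    simp only [Finset.sum_empty]
    exact HasCompactSupport.zero
  | insert i s hi ih =>
    simp only [Finset.sum_insert hi]
    exact (hc i).add ih

lemma tsupport_sum_subset {ι : Type*} {u : ι → E → ℝ} {S : Set E} (hS : ∀ k, tsupport (u k) ⊆ S)
    (s : Finset ι) : tsupport (fun y => ∑ k ∈ s, u k y) ⊆ S := by
  classical
  induction s using Finset.induction_on with
  | empty =>
    simp only [Finset.sum_empty]
    rw [show (fun _ : E => (0 : ℝ)) = 0 from rfl, tsupport_zero]
    exact empty_subset _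
  | insert i s hi ih =>
    simp only [Finset.sum_insert hi]
    exact (tsupport_add _ _).trans (union_subset (hS i) ih)

end FiniteSums

/-! ### Smooth functions and their series in Sobolev spaces -/

section Sobolev

variable {E : Type*} [NormedAddCommGroup E] [InnerProductSpace ℝ E] [FiniteDimensional ℝ E]
  [MeasurableSpace E] [BorelSpace E] {Ω : Set E}

lemma isSobolev_of_contDiff {u : E → ℝ} (hu : ContDiff ℝ ∞ u) (hc : HasCompactSupport u) :
    IsSobolev Ω u (gradient u) where
  integrable := (hu.continuous.integrable_of_hasCompactSupport hc).integrableOn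
  integrable_grad := ((continuous_gradient hu).integrable_of_hasCompactSupport
    (hasCompactSupport_gradient hc)).integrableOn
  weak_grad φ hφ v := by
    have hφd : Continuous fun x => fderiv ℝ φ x v :=
      (hφ.1.continuous_fderiv (by simp)).clm_apply continuous_const
    have hud : Continuous fun x => fderiv ℝ u x v :=
      (hu.continuous_fderiv (by simp)).clm_apply continuous_const
    have h0 : ∀ x, x ∉ Ω → φ x = 0 := fun x hx =>
      image_eq_zero_of_notMem_tsupport fun h => hx (hφ.2.2 h)
    have h0' : ∀ x, x ∉ Ω → fderiv ℝ φ x v = 0 := fun x hx => by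
      rw [image_eq_zero_of_notMem_tsupport
        fun h => hx (hφ.2.2 (tsupport_fderiv_subset ℝ h))]
      rfl
    rw [setIntegral_eq_integral_of_forall_compl_eq_zero fun x hx => by rw [h0' x hx, mul_zero],
      setIntegral_eq_integral_of_forall_compl_eq_zero fun x hx => by rw [h0 x hx, zero_mul]]
    have h1 : Integrable fun x => fderiv ℝ u x v * φ x :=
      (hud.mul hφ.1.continuous).integrable_of_hasCompactSupport hφ.2.1.mul_left
    have h2 : Integrable fun x => u x * fderiv ℝ φ x v :=
      (hu.continuous.mul hφd).integrable_of_hasCompactSupport hc.mul_right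
    have h3 : Integrable fun x => u x * φ x :=
      (hu.continuous.mul hφ.1.continuous).integrable_of_hasCompactSupport hc.mul_right
    rw [integral_mul_fderiv_eq_neg_fderiv_mul_of_integrable h1 h2 h3
      (fun x _ => hu.differentiable (by simp) x) (fun x _ => hφ.1.differentiable (by simp) x)]
    congr 1
    refine integral_congr_ae (Eventually.of_forall fun x => ?_)
    simp only [inner_gradient_left]
    ring

lemma tendsto_integral_of_norm_sub_le {α B C : Type*} [MeasurableSpace α] {μ : Measure α}
    [NormedAddCommGroup B] [NormedAddCommGroup C] [NormedSpace ℝ C] {F : ℕ → α → B} {f : α → B}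
    {T : ℕ → α → C} {t : α → C} {c : ℝ} (hT : ∀ k, Integrable (T k) μ) (ht : Integrable t μ)
    (hc : ∀ k x, ‖T k x - t x‖ ≤ c * ‖F k x - f x‖)
    (h : Tendsto (fun k => eLpNorm (fun x => F k x - f x) 1 μ) atTop (𝓝 0)) :
    Tendsto (fun k => ∫ x, T k x ∂μ) atTop (𝓝 (∫ x, t x ∂μ)) := by
  refine tendsto_integral_of_L1' t ht.aestronglyMeasurable (Eventually.of_forall hT) ?_
  have h1 : Tendsto (fun k => ENNReal.ofReal c * eLpNorm (fun x => F k x - f x) 1 μ) atTop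
      (𝓝 0) := by
    simpa using ENNReal.Tendsto.const_mul h (Or.inr ENNReal.ofReal_ne_top)
  refine tendsto_of_tendsto_of_tendsto_of_le_of_le tendsto_const_nhds h1 (fun _ => zero_le)
    fun k => ?_
  exact eLpNorm_le_mul_eLpNorm_of_ae_le_mul (Eventually.of_forall fun x => hc k x) 1

/-- Both sides of the integration by parts formula are continuous under `L¹` convergence, since a
test function and its derivatives are bounded. -/
lemma IsSobolev.of_tendsto {U : ℕ → E → ℝ} {V : ℕ → E → E} {u : E → ℝ} {G : E → E}
    (hUV : ∀ k, IsSobolev Ω (U k) (V k)) (hu : IntegrableOn u Ω) (hG : IntegrableOn G Ω)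
    (hU : Tendsto (fun k => eLpNorm (fun x => U k x - u x) 1 (volume.restrict Ω)) atTop (𝓝 0))
    (hV : Tendsto (fun k => eLpNorm (fun x => V k x - G x) 1 (volume.restrict Ω)) atTop (𝓝 0)) :
    IsSobolev Ω u G where
  integrable := hu
  integrable_grad := hG
  weak_grad φ hφ v := by
    have hφd : Continuous fun x => fderiv ℝ φ x v :=
      (hφ.1.continuous_fderiv (by simp)).clm_apply continuous_const
    have hφdc : HasCompactSupport fun x => fderiv ℝ φ x v := hφ.2.1.fderiv_apply ℝ v
    obtain ⟨C₁, hC₁⟩ := hφdc.exists_bound_of_continuous hφd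
    obtain ⟨C₂, hC₂⟩ := hφ.2.1.exists_bound_of_continuous hφ.1.continuous
    have hi1 : ∀ w : E → ℝ, IntegrableOn w Ω → IntegrableOn (fun x => w x * fderiv ℝ φ x v) Ω :=
      fun w hw => hw.mul_bdd (c := C₁) hφd.aestronglyMeasurable (Eventually.of_forall hC₁)
    have hi2 : ∀ W : E → E, IntegrableOn W Ω → IntegrableOn (fun x => φ x * inner ℝ (W x) v) Ω :=
      fun W hW => (hW.inner_const v).bdd_mul (c := C₂) hφ.1.continuous.aestronglyMeasurable
        (Eventually.of_forall hC₂)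
    have h1 : Tendsto (fun k => ∫ x in Ω, U k x * fderiv ℝ φ x v) atTop
        (𝓝 (∫ x in Ω, u x * fderiv ℝ φ x v)) := by
      refine tendsto_integral_of_norm_sub_le (c := C₁) (fun k => hi1 _ (hUV k).integrable)
        (hi1 _ hu) (fun k x => ?_) hU
      rw [← sub_mul, norm_mul, mul_comm]
      gcongr
      exact hC₁ x
    have h2 : Tendsto (fun k => ∫ x in Ω, φ x * inner ℝ (V k x) v) atTop
        (𝓝 (∫ x in Ω, φ x * inner ℝ (G x) v)) := by
      refine tendsto_integral_of_norm_sub_le (c := C₂ * ‖v‖)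
        (fun k => hi2 _ (hUV k).integrable_grad) (hi2 _ hG) (fun k x => ?_) hV
      rw [← mul_sub, ← inner_sub_left, norm_mul, mul_assoc, mul_comm ‖v‖]
      exact mul_le_mul (hC₂ x) (norm_inner_le_norm _ _) (norm_nonneg _)
        ((norm_nonneg _).trans (hC₂ x))
    refine tendsto_nhds_unique h1 ?_
    simp_rw [fun k => (hUV k).weak_grad φ hφ v]
    exact h2.neg

lemma isSobolev_tsum {u : ℕ → E → ℝ} (hu : ∀ k, ContDiff ℝ ∞ (u k))
    (hc : ∀ k, HasCompactSupport (u k)) (h0 : ∑' k, ∫⁻ x in Ω, ‖u k x‖ₑ ≠ ⊤)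
    (h1 : ∑' k, ∫⁻ x in Ω, ‖gradient (u k) x‖ₑ ≠ ⊤) :
    IsSobolev Ω (fun x => ∑' k, u k x) (fun x => ∑' k, gradient (u k) x) := by
  have hm0 : ∀ k, AEStronglyMeasurable (u k) (volume.restrict Ω) := fun k =>
    (hu k).continuous.aestronglyMeasurable
  have hm1 : ∀ k, AEStronglyMeasurable (gradient (u k)) (volume.restrict Ω) := fun k =>
    (continuous_gradient (hu k)).aestronglyMeasurable
  refine IsSobolev.of_tendsto (U := fun N x => ∑ k ∈ Finset.range N, u k x)
    (fun N => isSobolev_of_contDiff (ContDiff.sum fun k _ => hu k) (hasCompactSupport_sum hc _))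
    (integrable_tsum hm0 h0) (integrable_tsum hm1 h1) (tendsto_eLpNorm_sum_sub_tsum hm0 h0) ?_
  simp_rw [fun N x => gradient_sum_eq hu (Finset.range N) x]
  exact tendsto_eLpNorm_sum_sub_tsum hm1 h1

lemma isSobolevZero_tsum {u : ℕ → E → ℝ} (hu : ∀ k, IsTestFunction Ω (u k))
    (h0 : ∑' k, ∫⁻ x in Ω, ‖u k x‖ₑ ≠ ⊤) (h1 : ∑' k, ∫⁻ x in Ω, ‖gradient (u k) x‖ₑ ≠ ⊤) :
    IsSobolevZero Ω (fun x => ∑' k, u k x) (fun x => ∑' k, gradient (u k) x) := by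
  refine ⟨isSobolev_tsum (fun k => (hu k).1) (fun k => (hu k).2.1) h0 h1,
    fun N x => ∑ k ∈ Finset.range N, u k x, fun N => ⟨ContDiff.sum fun k _ => (hu k).1,
      hasCompactSupport_sum (fun k => (hu k).2.1) _, tsupport_sum_subset (fun k => (hu k).2.2) _⟩,
    tendsto_eLpNorm_sum_sub_tsum (fun k => (hu k).1.continuous.aestronglyMeasurable) h0, ?_⟩
  simp_rw [fun N x => gradient_sum_eq (fun k => (hu k).1) (Finset.range N) x]
  exact tendsto_eLpNorm_sum_sub_tsum
    (fun k => (continuous_gradient (hu k).1).aestronglyMeasurable) h1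

end Sobolev

/-! ### Slices at fixed `x₁` -/

section Slices

variable {n₁ m : ℕ} {n : Fin m → ℕ} {Ω₁ : Set (EuclideanSpace ℝ (Fin n₁))} {Ω₂ : Set (Rest n)}

lemma measurePreserving_toLp_restrict (hΩ₁ : MeasurableSet Ω₁) (hΩ₂ : MeasurableSet Ω₂) :
    MeasurePreserving (fun z : EuclideanSpace ℝ (Fin n₁) × Rest n => WithLp.toLp 2 z)
      ((volume.restrict Ω₁).prod (volume.restrict Ω₂)) (volume.restrict (cartesian Ω₁ Ω₂)) := by
  rw [Measure.prod_restrict]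
  exact (WithLp.volume_preserving_toLp (EuclideanSpace ℝ (Fin n₁)) (Rest n)).restrict_preimage
    (measurableSet_cartesian hΩ₁ hΩ₂)

lemma ae_ae_slice (hΩ₁ : MeasurableSet Ω₁) (hΩ₂ : MeasurableSet Ω₂) {P : Total n₁ n → Prop}
    (h : ∀ᵐ x ∂(volume.restrict (cartesian Ω₁ Ω₂)), P x) :
    ∀ᵐ x₁ ∂(volume.restrict Ω₁), ∀ᵐ y ∂(volume.restrict Ω₂), P (WithLp.toLp 2 (x₁, y)) :=
  Measure.ae_ae_of_ae_prod
    ((measurePreserving_toLp_restrict hΩ₁ hΩ₂).quasiMeasurePreserving.ae h)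

lemma ae_lintegral_slice_lt_top (hΩ₁ : MeasurableSet Ω₁) (hΩ₂ : MeasurableSet Ω₂)
    {g : Total n₁ n → ℝ≥0∞} (hg : AEMeasurable g (volume.restrict (cartesian Ω₁ Ω₂)))
    (h : ∫⁻ x in cartesian Ω₁ Ω₂, g x ≠ ⊤) :
    ∀ᵐ x₁ ∂(volume.restrict Ω₁), ∫⁻ y in Ω₂, g (WithLp.toLp 2 (x₁, y)) < ⊤ := by
  have hmp := measurePreserving_toLp_restrict (n := n) hΩ₁ hΩ₂
  have hg' : AEMeasurable (fun z => g (WithLp.toLp 2 z))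
      ((volume.restrict Ω₁).prod (volume.restrict Ω₂)) := hg.comp_quasiMeasurePreserving hmp.quasiMeasurePreserving
  rw [← hmp.map_eq, lintegral_map' (hmp.map_eq ▸ hg) hmp.aemeasurable, lintegral_prod _ hg'] at h
  exact ae_lt_top' hg'.lintegral_prod_right' h

/-- The support of a slice is closed, lies in the slice of `tsupport u`, and is contained in the
compact projection of `tsupport u`. -/
lemma isTestFunction_slice {u : Total n₁ n → ℝ} (hu : ContDiff ℝ ∞ u) (hc : HasCompactSupport u)
    (hs : tsupport u ⊆ {x | x.snd ∈ Ω₂}) (x₁ : EuclideanSpace ℝ (Fin n₁)) :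
    IsTestFunction Ω₂ fun y => u (WithLp.toLp 2 (x₁, y)) := by
  have hι : ContDiff ℝ ∞ fun y : Rest n => (WithLp.toLp 2 (x₁, y) : Total n₁ n) :=
    (WithLp.prodContinuousLinearEquiv 2 ℝ (EuclideanSpace ℝ (Fin n₁))
      (Rest n)).symm.contDiff.comp (contDiff_prodMk_right x₁)
  have hsub : tsupport (fun y => u (WithLp.toLp 2 (x₁, y))) ⊆
      (fun y => WithLp.toLp 2 (x₁, y)) ⁻¹' tsupport u :=
    closure_minimal (fun y hy => subset_tsupport u hy)
      ((isClosed_tsupport u).preimage hι.continuous)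
  refine ⟨hu.comp hι, ?_, fun y hy => hs (hsub hy)⟩
  refine HasCompactSupport.of_support_subset_isCompact
    (IsCompact.image hc (WithLp.continuous_snd 2 _ _)) fun y hy => ?_
  exact ⟨_, subset_tsupport u hy, rfl⟩

lemma gradient_slice {u : Total n₁ n → ℝ} (hu : Differentiable ℝ u)
    (x₁ : EuclideanSpace ℝ (Fin n₁)) (y : Rest n) :
    gradient (fun y => u (WithLp.toLp 2 (x₁, y))) y =
      (gradient u (WithLp.toLp 2 (x₁, y))).snd := by
  refine ext_inner_right ℝ fun z => ?_
  have h1 : HasFDerivAt (fun y : Rest n => (WithLp.toLp 2 (x₁, y) : Total n₁ n))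
      (((WithLp.prodContinuousLinearEquiv 2 ℝ (EuclideanSpace ℝ (Fin n₁)) (Rest n)).symm :
        (EuclideanSpace ℝ (Fin n₁) × Rest n) →L[ℝ] Total n₁ n).comp
          (ContinuousLinearMap.inr ℝ (EuclideanSpace ℝ (Fin n₁)) (Rest n))) y :=
    (WithLp.prodContinuousLinearEquiv 2 ℝ (EuclideanSpace ℝ (Fin n₁))
      (Rest n)).symm.hasFDerivAt.comp y (hasFDerivAt_prodMk_right x₁ y)
  have h2 : HasFDerivAt (fun y => u (WithLp.toLp 2 (x₁, y))) _ y :=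
    (hu (WithLp.toLp 2 (x₁, y))).hasFDerivAt.comp y h1
  have h3 : fderiv ℝ (fun y => u (WithLp.toLp 2 (x₁, y))) y z =
      fderiv ℝ u (WithLp.toLp 2 (x₁, y)) (WithLp.toLp 2 (0, z)) := by
    rw [h2.fderiv]; rfl
  rw [inner_gradient_left, h3, ← inner_gradient_left, WithLp.prod_inner_apply]
  simp

end Slices

/-! ### The sum of the series of thin extensions -/

section Assembly

variable {n₁ m : ℕ} {n : Fin m → ℕ} {Ω₁ : Set (EuclideanSpace ℝ (Fin n₁))} {Ω₂ : Set (Rest n)}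
  {p : Fin m → ℝ} {ε : ℝ} {φ u : ℕ → Total n₁ n → ℝ} {A δ : ℕ → ℝ≥0∞}

lemma enorm_le_enorm_fst_add_enorm_snd (x : Total n₁ n) : ‖x‖ₑ ≤ ‖x.fst‖ₑ + ‖x.snd‖ₑ := by
  have h1 : x = WithLp.toLp 2 (x.fst, 0) + WithLp.toLp 2 (0, x.snd) := by
    apply WithLp.ofLp_injective
    ext1 <;> simp
  have h2 : ‖(WithLp.toLp 2 (x.fst, 0) : Total n₁ n)‖ₑ = ‖x.fst‖ₑ := by
    rw [← ofReal_norm, WithLp.norm_toLp_fst, ofReal_norm]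
  have h3 : ‖(WithLp.toLp 2 (0, x.snd) : Total n₁ n)‖ₑ = ‖x.snd‖ₑ := by
    rw [← ofReal_norm, WithLp.norm_toLp_snd, ofReal_norm]
  calc ‖x‖ₑ = ‖(WithLp.toLp 2 (x.fst, 0) : Total n₁ n) + WithLp.toLp 2 (0, x.snd)‖ₑ := by rw [← h1]
    _ ≤ _ := by rw [← h2, ← h3]; exact enorm_add_le _ _

lemma tsum_lintegral_ne_top (h : ∀ k, IsThinExtension Ω₁ Ω₂ p ε (φ k) (u k) (A k) (δ k))
    (hδ : ∑' k, δ k ≠ ⊤) : ∑' k, ∫⁻ x in cartesian Ω₁ Ω₂, ‖u k x‖ₑ ≠ ⊤ :=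
  ((ENNReal.tsum_le_tsum fun k => (h k).lintegral_le).trans_lt hδ.lt_top).ne

lemma tsum_lintegral_gradient_ne_top
    (h : ∀ k, IsThinExtension Ω₁ Ω₂ p ε (φ k) (u k) (A k) (δ k))
    (hA : ∑' k, A k ≠ ⊤) (hδ : ∑' k, δ k ≠ ⊤) :
    ∑' k, ∫⁻ x in cartesian Ω₁ Ω₂, ‖gradient (u k) x‖ₑ ≠ ⊤ := by
  have h1 : ∀ k, ∫⁻ x in cartesian Ω₁ Ω₂, ‖gradient (u k) x‖ₑ ≤ A k + δ k := fun k => by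
    have hm : Measurable fun x => ‖(gradient (u k) x).fst‖ₑ :=
      ((WithLp.continuous_fst 2 (EuclideanSpace ℝ (Fin n₁)) (Rest n)).comp
        (continuous_gradient (h k).contDiff)).enorm.measurable
    refine (lintegral_mono fun x => enorm_le_enorm_fst_add_enorm_snd _).trans ?_
    rw [lintegral_add_left hm]
    exact add_le_add (h k).lintegral_fst_le (h k).lintegral_snd_le
  refine ((ENNReal.tsum_le_tsum h1).trans_lt ?_).ne
  rw [ENNReal.tsum_add]
  exact ENNReal.add_lt_top.2 ⟨hA.lt_top, hδ.lt_top⟩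

lemma ae_summable_gradient (h : ∀ k, IsThinExtension Ω₁ Ω₂ p ε (φ k) (u k) (A k) (δ k))
    (hA : ∑' k, A k ≠ ⊤) (hδ : ∑' k, δ k ≠ ⊤) :
    ∀ᵐ x ∂(volume.restrict (cartesian Ω₁ Ω₂)), Summable fun k => gradient (u k) x :=
  ae_summable_of_tsum_lintegral_ne_top
    (fun k => (continuous_gradient (h k).contDiff).aestronglyMeasurable)
    (tsum_lintegral_gradient_ne_top h hA hδ)

/-- `T` selects a block of the gradient. It commutes with the series almost everywhere, and bounds
for finite sums, which are again thin extensions, pass to the limit by Fatou. -/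
lemma eLpNorm_clm_tsum_gradient_le
    (h : ∀ k, IsThinExtension Ω₁ Ω₂ p ε (φ k) (u k) (A k) (δ k))
    (hA : ∑' k, A k ≠ ⊤) (hδ : ∑' k, δ k ≠ ⊤) {B : Type*} [NormedAddCommGroup B]
    [NormedSpace ℝ B] (T : Total n₁ n →L[ℝ] B) {q C : ℝ≥0∞}
    (hC : ∀ N, eLpNorm (fun x => T (gradient (fun y => ∑ k ∈ Finset.range N, u k y) x)) q
      (volume.restrict (cartesian Ω₁ Ω₂)) ≤ C) :
    eLpNorm (fun x => T (∑' k, gradient (u k) x)) q (volume.restrict (cartesian Ω₁ Ω₂)) ≤ C := by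
  have hs := ae_summable_gradient h hA hδ
  rw [eLpNorm_congr_ae (g := fun x => ∑' k, T (gradient (u k) x))
    (by filter_upwards [hs] with x hx using T.map_tsum hx)]
  refine eLpNorm_tsum_le_of_sum_le
    (fun k => (T.continuous.comp (continuous_gradient (h k).contDiff)).aestronglyMeasurable)
    (by filter_upwards [hs] with x hx using hx.mapL T) fun N => ?_
  refine le_trans (le_of_eq ?_) (hC N)
  congr 1 with x
  rw [gradient_sum_eq fun k => (h k).contDiff, map_sum]
  rfl

lemma eLpNorm_fst_tsum_gradient_le (hp : ∀ i, 1 < p i)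
    (h : ∀ k, IsThinExtension Ω₁ Ω₂ p ε (φ k) (u k) (A k) (δ k))
    (hA : ∑' k, A k ≠ ⊤) (hδ : ∑' k, δ k ≠ ⊤) :
    eLpNorm (fun x => (∑' k, gradient (u k) x).fst) 1 (volume.restrict (cartesian Ω₁ Ω₂)) ≤
      ∑' k, A k := by
  refine eLpNorm_clm_tsum_gradient_le h hA hδ (WithLp.fstL 2 ℝ _ _) fun N => ?_
  rw [eLpNorm_one_eq_lintegral_enorm]
  exact (IsThinExtension.sum hp (Finset.range N) fun k _ => h k).lintegral_fst_le.trans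
    (ENNReal.sum_le_tsum _)

lemma eLpNorm_snd_tsum_gradient_le (hp : ∀ i, 1 < p i)
    (h : ∀ k, IsThinExtension Ω₁ Ω₂ p ε (φ k) (u k) (A k) (δ k))
    (hA : ∑' k, A k ≠ ⊤) (hδ : ∑' k, δ k ≠ ⊤) (i : Fin m) :
    eLpNorm (fun x => (∑' k, gradient (u k) x).snd i) (ENNReal.ofReal (p i))
      (volume.restrict (cartesian Ω₁ Ω₂)) ≤ ∑' k, δ k :=
  eLpNorm_clm_tsum_gradient_le h hA hδ
    ((PiLp.proj 2 (fun i : Fin m => EuclideanSpace ℝ (Fin (n i))) i).comp (WithLp.sndL 2 ℝ _ _))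
    fun N => ((IsThinExtension.sum hp (Finset.range N) fun k _ => h k).eLpNorm_snd_le i).trans
      (ENNReal.sum_le_tsum _)

lemma isSobolev_tsum_of_thin (h : ∀ k, IsThinExtension Ω₁ Ω₂ p ε (φ k) (u k) (A k) (δ k))
    (hA : ∑' k, A k ≠ ⊤) (hδ : ∑' k, δ k ≠ ⊤) :
    IsSobolev (cartesian Ω₁ Ω₂) (fun x => ∑' k, u k x) (fun x => ∑' k, gradient (u k) x) :=
  isSobolev_tsum (fun k => (h k).contDiff) (fun k => (h k).hasCompactSupport)
    (tsum_lintegral_ne_top h hδ) (tsum_lintegral_gradient_ne_top h hA hδ)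

/-- By Tonelli, for almost every `x₁` the slices form a series of test functions on `Ω₂` that
converges absolutely in `W^{1,1}`; its sum is therefore in the closure of the test functions. -/
lemma ae_memSobolevZeroRest_slice (hΩ₁ : IsOpen Ω₁) (hΩ₂ : IsOpen Ω₂) (hp : ∀ i, 1 < p i)
    (h : ∀ k, IsThinExtension Ω₁ Ω₂ p ε (φ k) (u k) (A k) (δ k))
    (hA : ∑' k, A k ≠ ⊤) (hδ : ∑' k, δ k ≠ ⊤) :
    ∀ᵐ x₁ ∂(volume.restrict Ω₁),
      MemSobolevZeroRest Ω₂ p fun y => ∑' k, u k (WithLp.toLp 2 (x₁, y)) := by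
  have hm₁ := hΩ₁.measurableSet
  have hm₂ := hΩ₂.measurableSet
  have hsnd := WithLp.continuous_snd 2 (EuclideanSpace ℝ (Fin n₁)) (Rest n)
  have hι : ∀ x₁ : EuclideanSpace ℝ (Fin n₁),
      Continuous fun y : Rest n => (WithLp.toLp 2 (x₁, y) : Total n₁ n) := fun x₁ =>
    (WithLp.prod_continuous_toLp 2 _ _).comp (by fun_prop)
  have hm0 : ∀ k, Measurable fun x => ‖u k x‖ₑ := fun k =>
    (h k).contDiff.continuous.enorm.measurable
  have hm1 : ∀ k, Measurable fun x => ‖(gradient (u k) x).snd‖ₑ := fun k =>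
    (hsnd.comp (continuous_gradient (h k).contDiff)).enorm.measurable
  have e0 := ae_lintegral_slice_lt_top (g := fun x => ∑' k, ‖u k x‖ₑ) hm₁ hm₂
    (Measurable.tsum hm0).aemeasurable (by
      rw [lintegral_tsum fun k => (hm0 k).aemeasurable]
      exact tsum_lintegral_ne_top h hδ)
  have e1 := ae_lintegral_slice_lt_top (g := fun x => ∑' k, ‖(gradient (u k) x).snd‖ₑ) hm₁ hm₂
    (Measurable.tsum hm1).aemeasurable (by
      rw [lintegral_tsum fun k => (hm1 k).aemeasurable]
      exact ((ENNReal.tsum_le_tsum fun k => (h k).lintegral_snd_le).trans_lt hδ.lt_top).ne)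
  have hGm : ∀ i, AEStronglyMeasurable (fun x => (∑' k, gradient (u k) x).snd i)
      (volume.restrict (cartesian Ω₁ Ω₂)) := fun i =>
    ((PiLp.continuous_apply 2 _ i).comp hsnd).comp_aestronglyMeasurable
      (isSobolev_tsum_of_thin h hA hδ).integrable_grad.aestronglyMeasurable
  have hp0 : ∀ i, ENNReal.ofReal (p i) ≠ 0 := fun i => by
    have := hp i
    simp only [ne_eq, ENNReal.ofReal_eq_zero, not_le]
    linarith
  have e2 : ∀ᵐ x₁ ∂(volume.restrict Ω₁), ∀ i, ∫⁻ y in Ω₂,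
      ‖(∑' k, gradient (u k) (WithLp.toLp 2 (x₁, y))).snd i‖ₑ ^ (ENNReal.ofReal (p i)).toReal <
        ⊤ := by
    rw [ae_all_iff]
    intro i
    refine ae_lintegral_slice_lt_top
      (g := fun x => ‖(∑' k, gradient (u k) x).snd i‖ₑ ^ (ENNReal.ofReal (p i)).toReal) hm₁ hm₂
      ((hGm i).enorm.pow_const _) (ne_of_lt ?_)
    rw [← eLpNorm_lt_top_iff_lintegral_rpow_enorm_lt_top (hp0 i) ENNReal.ofReal_ne_top]
    exact (eLpNorm_snd_tsum_gradient_le hp h hA hδ i).trans_lt hδ.lt_top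
  have e3 := ae_ae_slice hm₁ hm₂ (ae_summable_gradient h hA hδ)
  filter_upwards [e0, e1, e2, e3] with x₁ hx0 hx1 hx2 hx3
  have hg : ∀ k y, gradient (fun y => u k (WithLp.toLp 2 (x₁, y))) y =
      (gradient (u k) (WithLp.toLp 2 (x₁, y))).snd := fun k y =>
    gradient_slice ((h k).contDiff.differentiable (by simp)) x₁ y
  have hcg : ∀ k, Continuous fun y => (gradient (u k) (WithLp.toLp 2 (x₁, y))).snd := fun k =>
    hsnd.comp ((continuous_gradient (h k).contDiff).comp (hι x₁))
  refine ⟨_, isSobolevZero_tsum (fun k => isTestFunction_slice (h k).contDiff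
    (h k).hasCompactSupport (h k).tsupport_subset x₁) ?_ ?_, fun i => ?_⟩
  · have hm : ∀ k, Measurable fun y => ‖u k (WithLp.toLp 2 (x₁, y))‖ₑ := fun k =>
      (hm0 k).comp (hι x₁).measurable
    rw [← lintegral_tsum fun k => (hm k).aemeasurable]
    exact hx0.ne
  · simp_rw [hg]
    rw [← lintegral_tsum fun k => (hcg k).enorm.measurable.aemeasurable]
    exact hx1.ne
  -- The sum of the slice gradients agrees with the slice of the summed gradient only where the full
  -- series converges, hence for almost every `y`.
  · have heq : (fun y => (∑' k, gradient (fun y => u k (WithLp.toLp 2 (x₁, y))) y) i)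
        =ᵐ[volume.restrict Ω₂]
          fun y => (∑' k, gradient (u k) (WithLp.toLp 2 (x₁, y))).snd i := by
      filter_upwards [hx3] with y hy
      simp_rw [hg]
      exact congrArg (fun v : Rest n => v i) ((WithLp.sndL 2 ℝ _ _).map_tsum hy).symm
    have hsm : ∀ᵐ y ∂(volume.restrict Ω₂),
        Summable fun k => (gradient (u k) (WithLp.toLp 2 (x₁, y))).snd := by
      filter_upwards [hx3] with y hy using hy.mapL (WithLp.sndL 2 ℝ _ _)
    have hmeas : AEStronglyMeasurable
        (fun y => (∑' k, gradient (fun y => u k (WithLp.toLp 2 (x₁, y))) y) i)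
        (volume.restrict Ω₂) := by
      simp_rw [hg]
      exact (PiLp.continuous_apply 2 _ i).comp_aestronglyMeasurable
        (aestronglyMeasurable_tsum (fun k => (hcg k).aestronglyMeasurable) hsm)
    refine ⟨hmeas, ?_⟩
    rw [eLpNorm_congr_ae heq,
      eLpNorm_lt_top_iff_lintegral_rpow_enorm_lt_top (hp0 i) ENNReal.ofReal_ne_top]
    exact hx2 i

lemma isWeakZeroSobolev_tsum (hΩ₁ : IsOpen Ω₁) (hΩ₂ : IsOpen Ω₂) (hp : ∀ i, 1 < p i)
    (h : ∀ k, IsThinExtension Ω₁ Ω₂ p ε (φ k) (u k) (A k) (δ k))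
    (hA : ∑' k, A k ≠ ⊤) (hδ : ∑' k, δ k ≠ ⊤) :
    IsWeakZeroSobolev Ω₁ Ω₂ p (fun x => ∑' k, u k x) (fun x => ∑' k, gradient (u k) x) := by
  have hS := isSobolev_tsum_of_thin h hA hδ
  have hsnd := WithLp.continuous_snd 2 (EuclideanSpace ℝ (Fin n₁)) (Rest n)
  refine ⟨hS, ⟨?_, ?_⟩, fun i => ⟨?_, ?_⟩, ae_memSobolevZeroRest_slice hΩ₁ hΩ₂ hp h hA hδ⟩
  · exact (WithLp.continuous_fst 2 _ _).comp_aestronglyMeasurable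
      hS.integrable_grad.aestronglyMeasurable
  · exact (eLpNorm_fst_tsum_gradient_le hp h hA hδ).trans_lt hA.lt_top
  · exact ((PiLp.continuous_apply 2 _ i).comp hsnd).comp_aestronglyMeasurable
      hS.integrable_grad.aestronglyMeasurable
  · exact (eLpNorm_snd_tsum_gradient_le hp h hA hδ i).trans_lt hδ.lt_top

/-- The continuous partial sums equal `∑ φ k` on the lateral boundary and vanish on the rest of
`∂Ω`, which does not lie over `Ω₂`. The trace is thus `f` extended by zero. -/
lemma hasTrace_tsum (hΩ₂ : IsOpen Ω₂)
    (h : ∀ k, IsThinExtension Ω₁ Ω₂ p ε (φ k) (u k) (A k) (δ k))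
    (hA : ∑' k, A k ≠ ⊤) (hδ : ∑' k, δ k ≠ ⊤) {f : Total n₁ n → ℝ}
    (hf : Integrable f (surfaceMeasure (cartesian (frontier Ω₁) Ω₂)))
    (hφ : Tendsto (fun N => ∫⁻ x, ‖∑ k ∈ Finset.range N, φ k x - f x‖ₑ
        ∂(surfaceMeasure (cartesian (frontier Ω₁) Ω₂))) atTop (𝓝 0)) :
    HasTrace (cartesian Ω₁ Ω₂) (fun x => ∑' k, u k x)
      ((cartesian (frontier Ω₁) Ω₂).indicator f) := by
  set F : Set (Total n₁ n) := cartesian (frontier Ω₁) Ω₂ with hF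
  have hFm : MeasurableSet F :=
    measurableSet_cartesian isClosed_frontier.measurableSet hΩ₂.measurableSet
  have hres : (surfaceMeasure (frontier (cartesian Ω₁ Ω₂))).restrict F = surfaceMeasure F :=
    Measure.restrict_restrict_of_subset (lateral_subset_frontier _ _)
  refine ⟨(integrable_indicator_iff hFm).2 (by rw [IntegrableOn, hres]; exact hf),
    _, isSobolev_tsum_of_thin h hA hδ, fun N x => ∑ k ∈ Finset.range N, u k x,
    fun N => gradient fun x => ∑ k ∈ Finset.range N, u k x, fun N => ⟨?_, ?_⟩, ?_, ?_, ?_⟩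
  · exact (ContDiff.sum fun k _ => (h k).contDiff).continuous.continuousOn
  · exact isSobolev_of_contDiff (ContDiff.sum fun k _ => (h k).contDiff)
      (hasCompactSupport_sum (fun k => (h k).hasCompactSupport) _)
  · exact tendsto_eLpNorm_sum_sub_tsum
      (fun k => (h k).contDiff.continuous.aestronglyMeasurable) (tsum_lintegral_ne_top h hδ)
  · simp_rw [fun N x => gradient_sum_eq (fun k => (h k).contDiff) (Finset.range N) x]
    exact tendsto_eLpNorm_sum_sub_tsum
      (fun k => (continuous_gradient (h k).contDiff).aestronglyMeasurable)
      (tsum_lintegral_gradient_ne_top h hA hδ)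
  · convert hφ using 2 with N
    rw [eLpNorm_one_eq_lintegral_enorm, ← hres, ← lintegral_indicator hFm]
    have hfr : MeasurableSet (frontier (cartesian Ω₁ Ω₂)) := isClosed_frontier.measurableSet
    refine setLIntegral_congr_fun hfr fun x hx => ?_
    by_cases hxF : x ∈ F
    · simp only [indicator_of_mem hxF]
      rw [Finset.sum_congr rfl fun k _ => (h k).eq_lateral x hxF]
    · have hx2 : x.snd ∉ Ω₂ := by
        rw [frontier_cartesian] at hx
        rcases hx with hx | hx
        · exact fun h2 => (hΩ₂.frontier_eq ▸ hx.2 : x.snd ∈ closure Ω₂ \ Ω₂).2 h2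
        · exact fun h2 => hxF ⟨hx.1, h2⟩
      have h0 : ∀ k, u k x = 0 := fun k =>
        image_eq_zero_of_notMem_tsupport fun hxs => hx2 ((h k).tsupport_subset hxs)
      simp [indicator_of_notMem hxF, h0]

lemma closure_support_tsum_subset
    (h : ∀ k, IsThinExtension Ω₁ Ω₂ p ε (φ k) (u k) (A k) (δ k)) :
    closure (cartesian Ω₁ Ω₂ ∩ Function.support fun x => ∑' k, u k x) ⊆
      Metric.cthickening ε (cartesian (frontier Ω₁) Ω₂) := by
  refine closure_minimal (fun x hx => ?_) Metric.isClosed_cthickening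
  by_contra hno
  refine hx.2 ?_
  have h0 : ∀ k, u k x = 0 := fun k => by
    by_contra hk
    exact hno ((h k).mem_cthickening x hx.1 hk)
  simp [h0]

/-- The `L^{p_i}` norms will be at most `t`, and the theorem bounds their `p_i`-th powers, hence `t
^ p i ≤ c` besides `t ≤ c`. If `c = 0`, then `f` vanishes almost everywhere and the zero series
serves. -/
lemma exists_small_thin_extension_series (hΩ₁ : IsOpen Ω₁) (hΩ₂ : IsOpen Ω₂)
    (hb₁ : Bornology.IsBounded Ω₁) (hb₂ : Bornology.IsBounded Ω₂)
    (hLip : HasLipschitzBoundary (cartesian Ω₁ Ω₂)) (hp : ∀ i, 1 < p i) (hε : 0 < ε)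
    {f : Total n₁ n → ℝ} (hf : Integrable f (surfaceMeasure (cartesian (frontier Ω₁) Ω₂))) {c : ℝ}
    (hc : c = ε * ∫ x, |f x| ∂(surfaceMeasure (cartesian (frontier Ω₁) Ω₂))) :
    ∃ (t : ℝ) (φ u : ℕ → Total n₁ n → ℝ) (A δ : ℕ → ℝ≥0∞), 0 ≤ t ∧ t ≤ c ∧
      (∀ i, t ^ p i ≤ c) ∧
      (∀ k, IsThinExtension Ω₁ Ω₂ p ε (φ k) (u k) (A k) (δ k)) ∧
      ∑' k, A k ≤ ∫⁻ x, ‖f x‖ₑ ∂(surfaceMeasure (cartesian (frontier Ω₁) Ω₂)) +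
        ENNReal.ofReal t ∧
      ∑' k, δ k ≤ ENNReal.ofReal t ∧
      Tendsto (fun N => ∫⁻ x, ‖∑ k ∈ Finset.range N, φ k x - f x‖ₑ
        ∂(surfaceMeasure (cartesian (frontier Ω₁) Ω₂))) atTop (𝓝 0) := by
  set μ := surfaceMeasure (cartesian (frontier Ω₁) Ω₂)
  have hc0 : 0 ≤ c := by
    rw [hc]
    exact mul_nonneg hε.le (integral_nonneg fun x => abs_nonneg _)
  rcases hc0.eq_or_lt with h0 | hcpos
  · have hI : ∫⁻ x, ‖f x‖ₑ ∂μ = 0 := by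
      have h1 : ∫ x, ‖f x‖ ∂μ = 0 := by
        rcases mul_eq_zero.1 (hc.symm.trans h0.symm) with h2 | h2
        · exact absurd h2 hε.ne'
        · exact h2
      rw [← ofReal_integral_norm_eq_lintegral_enorm hf, h1, ENNReal.ofReal_zero]
    refine ⟨0, fun _ _ => 0, fun _ _ => 0, fun _ => 0, fun _ => 0, le_rfl, hc0, fun i => ?_,
      fun _ => IsThinExtension.zero 0 0, by simp, by simp, ?_⟩
    · rw [Real.zero_rpow (by linarith [hp i])]
      exact hc0
    · simp [hI]
  · have h1 : ∀ᶠ t : ℝ in 𝓝[>] 0, ∀ i, t ^ p i < c := by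
      rw [eventually_all]
      intro i
      have h2 : Tendsto (fun t : ℝ => t ^ p i) (𝓝[>] 0) (𝓝 0) := by
        have := (Real.continuousAt_rpow_const 0 (p i) (Or.inr (by linarith [hp i]))).tendsto
        rw [Real.zero_rpow (by linarith [hp i])] at this
        exact this.mono_left nhdsWithin_le_nhds
      exact h2.eventually (gt_mem_nhds hcpos)
    obtain ⟨t, ht1, ht⟩ := (h1.and (Ioo_mem_nhdsGT hcpos)).exists
    obtain ⟨φ, u, A, δ, hk, hA, hδ, hφ⟩ := exists_thin_extension_series hΩ₁ hΩ₂ hb₁ hb₂ hLip hp hε hf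
      (η := ENNReal.ofReal t) (by simpa using ht.1)
    exact ⟨t, φ, u, A, δ, ht.1.le, ht.2.le, fun i => (ht1 i).le, hk, hA, hδ, hφ⟩

end Assembly

end AnisoGagliardo

end

/-! ### The theorem -/

theorem mainTheorem12 {n₁ m : ℕ} {n : Fin m → ℕ}
    (Ω₁ : Set (EuclideanSpace ℝ (Fin n₁))) (Ω₂ : Set (AnisoGagliardo.Rest n))
    (hΩ₁ : IsOpen Ω₁) (hΩ₂ : IsOpen Ω₂)
    (hb₁ : Bornology.IsBounded Ω₁) (hb₂ : Bornology.IsBounded Ω₂)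
    (hLip : AnisoGagliardo.HasLipschitzBoundary (AnisoGagliardo.cartesian Ω₁ Ω₂))
    (p : Fin m → ℝ) (hp : ∀ i, 1 < p i)
    (f : AnisoGagliardo.Total n₁ n → ℝ)
    (hf : Integrable f
      (AnisoGagliardo.surfaceMeasure (AnisoGagliardo.cartesian (frontier Ω₁) Ω₂)))
    (ε : ℝ) (hε : 0 < ε) :
    ∃ (u : AnisoGagliardo.Total n₁ n → ℝ)
      (G : AnisoGagliardo.Total n₁ n → AnisoGagliardo.Total n₁ n),
      AnisoGagliardo.IsWeakZeroSobolev Ω₁ Ω₂ p u G ∧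
      (∃ g : AnisoGagliardo.Total n₁ n → ℝ,
        AnisoGagliardo.HasTrace (AnisoGagliardo.cartesian Ω₁ Ω₂) u g ∧
        g =ᵐ[AnisoGagliardo.surfaceMeasure
          (AnisoGagliardo.cartesian (frontier Ω₁) Ω₂)] f) ∧
      AnisoGagliardo.cartesian Ω₁ Ω₂ ∩
          closure (AnisoGagliardo.cartesian Ω₁ Ω₂ ∩ Function.support u) ⊆
        Metric.cthickening ε (AnisoGagliardo.cartesian (frontier Ω₁) Ω₂) ∧
      ∫ x in AnisoGagliardo.cartesian Ω₁ Ω₂, ‖(G x).fst‖ ≤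
        (1 + ε) * ∫ x, |f x| ∂(AnisoGagliardo.surfaceMeasure
          (AnisoGagliardo.cartesian (frontier Ω₁) Ω₂)) ∧
      ∀ i, ∫ x in AnisoGagliardo.cartesian Ω₁ Ω₂, ‖(G x).snd i‖ ^ p i ≤
        ε * ∫ x, |f x| ∂(AnisoGagliardo.surfaceMeasure
          (AnisoGagliardo.cartesian (frontier Ω₁) Ω₂)) := by
  obtain ⟨t, φ, u, A, δ, ht0, htc, htp, h, hA, hδ, hφ⟩ :=
    AnisoGagliardo.exists_small_thin_extension_series hΩ₁ hΩ₂ hb₁ hb₂ hLip hp hε hf rfl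
  have hI : ∫⁻ x, ‖f x‖ₑ ∂(AnisoGagliardo.surfaceMeasure
      (AnisoGagliardo.cartesian (frontier Ω₁) Ω₂)) = ENNReal.ofReal (∫ x, |f x|
        ∂(AnisoGagliardo.surfaceMeasure (AnisoGagliardo.cartesian (frontier Ω₁) Ω₂))) :=
    (ofReal_integral_norm_eq_lintegral_enorm hf).symm
  set I := ∫ x, |f x| ∂(AnisoGagliardo.surfaceMeasure
    (AnisoGagliardo.cartesian (frontier Ω₁) Ω₂))
  have hI0 : 0 ≤ I := integral_nonneg fun x => abs_nonneg _
  rw [hI, ← ENNReal.ofReal_add hI0 ht0] at hA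
  have hA' : ∑' k, A k ≠ ⊤ := (hA.trans_lt ENNReal.ofReal_lt_top).ne
  have hδ' : ∑' k, δ k ≠ ⊤ := (hδ.trans_lt ENNReal.ofReal_lt_top).ne
  have hW := AnisoGagliardo.isWeakZeroSobolev_tsum hΩ₁ hΩ₂ hp h hA' hδ'
  have hFm : MeasurableSet (AnisoGagliardo.cartesian (frontier Ω₁) Ω₂) :=
    AnisoGagliardo.measurableSet_cartesian isClosed_frontier.measurableSet hΩ₂.measurableSet
  refine ⟨_, _, hW, ⟨_, AnisoGagliardo.hasTrace_tsum hΩ₂ h hA' hδ' hf hφ,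
    indicator_ae_eq_restrict hFm⟩,
    inter_subset_right.trans (AnisoGagliardo.closure_support_tsum_subset h), ?_, fun i => ?_⟩
  · rw [integral_norm_eq_lintegral_enorm hW.memLp_first.aestronglyMeasurable,
      ← eLpNorm_one_eq_lintegral_enorm]
    refine (ENNReal.toReal_le_of_le_ofReal (add_nonneg hI0 ht0)
      ((AnisoGagliardo.eLpNorm_fst_tsum_gradient_le hp h hA' hδ').trans hA)).trans ?_
    linarith
  · have hp0 : 0 < p i := by linarith [hp i]
    have h1 := (AnisoGagliardo.eLpNorm_snd_tsum_gradient_le hp h hA' hδ' i).trans hδ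
    rw [eLpNorm_eq_lintegral_rpow_enorm_toReal (by simpa using hp0) ENNReal.ofReal_ne_top,
      ENNReal.toReal_ofReal hp0.le, one_div, ENNReal.rpow_inv_le_iff hp0,
      ENNReal.ofReal_rpow_of_nonneg ht0 hp0.le] at h1
    rw [integral_eq_lintegral_of_nonneg_ae
      (Eventually.of_forall fun x => Real.rpow_nonneg (norm_nonneg _) _)
      ((hW.memLp_rest i).aestronglyMeasurable.norm.aemeasurable.pow_const _).aestronglyMeasurable]
    refine (ENNReal.toReal_le_of_le_ofReal (Real.rpow_nonneg ht0 _) ?_).trans (htp i)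
    refine le_trans (le_of_eq (lintegral_congr fun x => ?_)) h1
    rw [← ENNReal.ofReal_rpow_of_nonneg (norm_nonneg _) hp0.le, ofReal_norm]
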